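/- Let $C\subset\mathbb{R}^2$ be a plane convex body, that is, a compact convex set with non-empty interior. If $C$ is a parallelogram, then the spindle Carathéodory number and the ball Carathéodory number of $C$ are both equal to $2$; otherwise both are equal to $3$. Here a set $K\subseteq\mathbb{R}^2$ is called $C$-ball convex if $K=\emptyset$, or $K=\mathbb{R}^2$, or $K$ is the intersection of all translates of $C$ that contain $K$. For $p,q\in\mathbb{R}^2$ (not necessarily distinct), the $C$-spindle $[p,q]_C$ is the intersection of all translates of $C$ that contain both $p$ and $q$, and $[p,q]_C=\mathbb{R}^2$ if there is no such translate; $K$ is called $C$-spindle convex if $[p,q]_C\subseteq K$ for all $p,q\in K$. For a family $\mathcal{G}$ of subsets of $\mathbb{R}^2$ and $A\subseteq\mathbb{R}^2$, let $\operatorname{conv}_{\mathcal{G}}(A)$ be the intersection of all members of $\mathcal{G}$ that contain $A$. The Carathéodory number of $\mathcal{G}$ is the smallest positive integer $k$ such that for every closed set $V\subseteq\mathbb{R}^2$ and every $p\in\operatorname{conv}_{\mathcal{G}}(V)$ there is a set $W\subseteq V$ with at most $k$ elements and $p\in\operatorname{conv}_{\mathcal{G}}(W)$ (and $\infty$ if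 there is no such $k$). The spindle Carathéodory number of $C$ is the Carathéodory number of the family of all closed $C$-spindle convex sets, and the ball Carathéodory number of $C$ is that of the family of all $C$-ball convex sets. -/

import Mathlib

open scoped Pointwise

/-- A convex body: a compact convex set with non-empty interior. -/
def IsConvexBody {E : Type*} [AddCommGroup E] [Module ℝ E] [TopologicalSpace E]
    (C : Set E) : Prop :=
  IsCompact C ∧ Convex ℝ C ∧ (interior C).Nonempty

/-- A (nondegenerate) parallelogram: a translate of the set of all `s • u + t • v` with
`s, t ∈ [0, 1]`, where `u` and `v` are linearly independent. -/
def IsParallelogram {E : Type*} [AddCommGroup E] [Module ℝ E] (C : Set E) : Prop :=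
  ∃ a u v : E, LinearIndependent ℝ ![u, v] ∧ C = a +ᵥ parallelepiped ![u, v]

/-- The intersection of all translates of `C` that contain `A`. If there are no such translates,
this is the whole space. -/
def translateHull {E : Type*} [AddCommGroup E] (C A : Set E) : Set E :=
  ⋂ (u : E) (_ : A ⊆ u +ᵥ C), (u +ᵥ C)

/-- `K` is `C`-ball convex: it is empty, or the whole space, or the intersection of all
translates of `C` that contain it. -/
def IsBallConvex {E : Type*} [AddCommGroup E] (C K : Set E) : Prop :=
  K = ∅ ∨ K = Set.univ ∨ K = translateHull C K

/-- The `C`-spindle `[p, q]_C`: the intersection of all translates of `C` that contain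
`p` and `q`; the whole space if there are none. -/
def spindle {E : Type*} [AddCommGroup E] (C : Set E) (p q : E) : Set E :=
  translateHull C {p, q}

/-- `K` is `C`-spindle convex: it contains the `C`-spindle of any two (not necessarily distinct)
points of it. -/
def IsSpindleConvex {E : Type*} [AddCommGroup E] (C K : Set E) : Prop :=
  ∀ p ∈ K, ∀ q ∈ K, spindle C p q ⊆ K

/-- The hull of `A` in the convexity structure `G`: the intersection of the members of `G`
that contain `A`. -/
def structureHull {X : Type*} (G : Set (Set X)) (A : Set X) : Set X :=
  ⋂₀ {K | K ∈ G ∧ A ⊆ K}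

/-- The Carathéodory number of a convexity structure `G` on a topological space `X`: the smallest
positive integer `k` such that, for all closed `V ⊆ X`, each point of the hull of `V` is in the
hull of a subset of `V` with at most `k` points; it is `⊤` if there is no such `k`. -/
noncomputable def caratheodoryNumber {X : Type*} [TopologicalSpace X] (G : Set (Set X)) : ℕ∞ :=
  sInf ((fun k : ℕ => (k : ℕ∞)) '' {k : ℕ | 0 < k ∧
    ∀ V : Set X, IsClosed V → ∀ p ∈ structureHull G V,
      ∃ W ⊆ V, W.encard ≤ k ∧ p ∈ structureHull G W})

/-- The spindle Carathéodory number of `C`: that of the family of closed `C`-spindle convex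
sets. -/
noncomputable def spindleCaratheodoryNumber {E : Type*} [AddCommGroup E] [TopologicalSpace E]
    (C : Set E) : ℕ∞ :=
  caratheodoryNumber {K : Set E | IsClosed K ∧ IsSpindleConvex C K}

/-- The ball Carathéodory number of `C`: that of the family of `C`-ball convex sets. -/
noncomputable def ballCaratheodoryNumber {E : Type*} [AddCommGroup E] [TopologicalSpace E]
    (C : Set E) : ℕ∞ :=
  caratheodoryNumber {K : Set E | IsBallConvex C K}

/-!
A point `p` lies in the `C`-hull of `V` iff `p + w ∈ C` for every shift `w` with `V + w ⊆ C`. If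
there is no such shift, Helly's theorem already excludes one for three points of `V`, whose hull is
then the whole plane. Otherwise a boundary point `q` of the hull is moved to a boundary point of `C`
by some shift. If the spindle of no two points of `V` contained `q`, any two points of `V` could be
shifted within `C` further in the outer normal direction (or along the edge through `q`); Helly and
compactness turn this into a common shift of `V` that pushes `q` out of `C`. An interior point of
the hull lies on a segment from a point of `V` to a boundary point, so three points always suffice.
The spindle and ball numbers agree since closed spindle convex sets are ball convex: a separating
functional can be perturbed to have a unique maximizer on `C`, where the translate touches.

The hull of a finite set with respect to a parallelogram is computed coordinatewise, and two points
suffice. For the converse, consider the outer normals at smooth boundary points. If three of them,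
pairwise independent, sum to zero, the vertices of a small triangle around the origin form a set
whose centre is in no spindle of two vertices. Otherwise these normals form a symmetric cone
contained in two lines, and since they determine `C`, it is a parallelogram.
-/

open Filter Module Set Topology

section Hull

variable {E : Type*} [AddCommGroup E] {A B C : Set E} {p q u w x : E}

/-- The vectors `w` for which the shift of `A` by `w` lies in `C`; equivalently, those for which
the translate `-w +ᵥ C` contains `A`. Shifting points instead of translating `C` turns membership
in a hull into a family of membership conditions in the fixed set `C`. -/
def shiftsInto (A C : Set E) : Set E :=
  {w | ∀ a ∈ A, a + w ∈ C}

theorem subset_neg_vadd_iff : A ⊆ -w +ᵥ C ↔ w ∈ shiftsInto A C := by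
  simp only [subset_def, mem_vadd_set_iff_neg_vadd_mem, neg_neg, vadd_eq_add, shiftsInto,
    mem_ofPred_eq, add_comm w]

theorem shiftsInto_pair_iff : w ∈ shiftsInto {p, q} C ↔ p + w ∈ C ∧ q + w ∈ C := by
  simp [shiftsInto]

theorem shiftsInto_anti_left (h : A ⊆ B) : shiftsInto B C ⊆ shiftsInto A C :=
  fun _ hw a ha => hw a (h ha)

theorem mem_translateHull : x ∈ translateHull C A ↔ ∀ w ∈ shiftsInto A C, x + w ∈ C := by
  simp only [translateHull, mem_iInter]
  refine (Equiv.neg E).forall_congr_left.trans (forall_congr' fun w => ?_)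
  simp only [Equiv.neg_symm, Equiv.neg_apply, subset_neg_vadd_iff, mem_vadd_set_iff_neg_vadd_mem,
    neg_neg, vadd_eq_add, add_comm w]

theorem mem_spindle : x ∈ spindle C p q ↔ ∀ w, p + w ∈ C → q + w ∈ C → x + w ∈ C := by
  simp only [spindle, mem_translateHull, shiftsInto_pair_iff, and_imp]

theorem subset_translateHull : A ⊆ translateHull C A :=
  fun a ha => mem_translateHull.2 fun _ hw => hw a ha

theorem translateHull_mono (h : A ⊆ B) : translateHull C A ⊆ translateHull C B :=
  fun _ hx => mem_translateHull.2 fun _ hw => mem_translateHull.1 hx _ (shiftsInto_anti_left h hw)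

theorem translateHull_eq_univ (h : shiftsInto A C = ∅) : translateHull C A = univ :=
  eq_univ_of_forall fun _ => mem_translateHull.2 fun _ hw => (h.subset hw).elim

theorem shiftsInto_translateHull : shiftsInto (translateHull C A) C = shiftsInto A C :=
  (shiftsInto_anti_left subset_translateHull).antisymm
    fun w hw _ hx => mem_translateHull.1 hx w hw

theorem translateHull_idem : translateHull C (translateHull C A) = translateHull C A := by
  ext x
  rw [mem_translateHull, shiftsInto_translateHull, mem_translateHull]

theorem mem_shiftsInto_vadd : w ∈ shiftsInto A (u +ᵥ C) ↔ w - u ∈ shiftsInto A C := by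
  simp only [shiftsInto, mem_ofPred_eq, mem_vadd_set_iff_neg_vadd_mem, vadd_eq_add,
    neg_add_eq_sub, add_sub_assoc]

theorem translateHull_vadd : translateHull (u +ᵥ C) A = translateHull C A := by
  ext x
  simp only [mem_translateHull, mem_shiftsInto_vadd, mem_vadd_set_iff_neg_vadd_mem, vadd_eq_add,
    neg_add_eq_sub, add_sub_assoc]
  exact (Equiv.subRight u).forall_congr_left.trans (by simp)

theorem isBallConvex_translateHull : IsBallConvex C (translateHull C A) :=
  .inr (.inr translateHull_idem.symm)

theorem translateHull_subset_of_isBallConvex {K : Set E} (hK : IsBallConvex C K)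
    (hA : A.Nonempty) (hAK : A ⊆ K) : translateHull C A ⊆ K := by
  rcases hK with rfl | rfl | hK
  · exact (hA.mono hAK).ne_empty rfl |>.elim
  · exact subset_univ _
  · exact hK ▸ translateHull_mono hAK

theorem structureHull_isBallConvex_empty : structureHull {K | IsBallConvex C K} ∅ = ∅ :=
  subset_empty_iff.1 <| sInter_subset_of_mem (t := ∅) ⟨.inl rfl, subset_rfl⟩

theorem structureHull_isBallConvex (hA : A.Nonempty) :
    structureHull {K | IsBallConvex C K} A = translateHull C A := by
  refine Subset.antisymm (sInter_subset_of_mem ?_) (subset_sInter fun K hK => ?_)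
  · exact ⟨isBallConvex_translateHull, subset_translateHull⟩
  · exact translateHull_subset_of_isBallConvex hK.1 hA hK.2

end Hull

section Criteria

variable {E : Type*} [AddCommGroup E] [TopologicalSpace E] {C : Set E} {k : ℕ}

theorem ballCaratheodoryNumber_le (hk : 0 < k)
    (h : ∀ V : Set E, V.Nonempty → IsClosed V → ∀ p ∈ translateHull C V,
      ∃ W ⊆ V, W.encard ≤ k ∧ p ∈ translateHull C W) :
    ballCaratheodoryNumber C ≤ k := by
  refine sInf_le ⟨k, ⟨hk, fun V hV p hp => ?_⟩, rfl⟩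
  obtain rfl | hne := V.eq_empty_or_nonempty
  · simp [structureHull_isBallConvex_empty] at hp
  rw [structureHull_isBallConvex hne] at hp
  obtain ⟨W, hWV, hWk, hpW⟩ := h V hne hV p hp
  obtain rfl | hW := W.eq_empty_or_nonempty
  · obtain ⟨v, hv⟩ := hne
    refine ⟨{v}, singleton_subset_iff.2 hv, ?_, ?_⟩
    · rw [encard_singleton]
      exact_mod_cast hk
    · rw [structureHull_isBallConvex (singleton_nonempty v)]
      exact translateHull_mono (empty_subset _) hpW
  · exact ⟨W, hWV, hWk, (structureHull_isBallConvex hW).symm ▸ hpW⟩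

theorem le_ballCaratheodoryNumber {V : Set E} {p : E} (hne : V.Nonempty) (hV : IsClosed V)
    (hp : p ∈ translateHull C V)
    (h : ∀ W ⊆ V, W.encard < k → p ∉ translateHull C W) :
    k ≤ ballCaratheodoryNumber C := by
  refine le_sInf ?_
  rintro _ ⟨j, ⟨-, hj⟩, rfl⟩
  obtain ⟨W, hWV, hWj, hpW⟩ := hj V hV p (by rwa [structureHull_isBallConvex hne])
  by_contra! hjk
  refine h W hWV (hWj.trans_lt hjk) ?_
  obtain rfl | hW := W.eq_empty_or_nonempty
  · simp [structureHull_isBallConvex_empty] at hpW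
  · rwa [structureHull_isBallConvex hW] at hpW

end Criteria

section Topological

variable {E : Type*} [AddCommGroup E] {A C : Set E}

theorem shiftsInto_eq_iInter : shiftsInto A C = ⋂ a ∈ A, (a + ·) ⁻¹' C := by
  ext w
  simp only [shiftsInto, mem_ofPred_eq, mem_iInter, mem_preimage]

theorem convex_shiftsInto [Module ℝ E] (hC : Convex ℝ C) : Convex ℝ (shiftsInto A C) := by
  rw [shiftsInto_eq_iInter]
  exact convex_iInter₂ fun a _ => hC.translate_preimage_right a

theorem convex_translateHull [Module ℝ E] (hC : Convex ℝ C) : Convex ℝ (translateHull C A) :=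
  convex_iInter₂ fun u _ => hC.vadd u

variable [TopologicalSpace E] [IsTopologicalAddGroup E]

theorem isClosed_shiftsInto (hC : IsClosed C) : IsClosed (shiftsInto A C) := by
  rw [shiftsInto_eq_iInter]
  exact isClosed_biInter fun a _ => hC.preimage (continuous_const_add a)

theorem isCompact_shiftsInto [T2Space E] (hC : IsCompact C) (hA : A.Nonempty) :
    IsCompact (shiftsInto A C) := by
  obtain ⟨a, ha⟩ := hA
  exact ((Homeomorph.addLeft a).isCompact_preimage.2 hC).of_isClosed_subset
    (isClosed_shiftsInto hC.isClosed) fun w hw => hw a ha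

theorem isClosed_translateHull (hC : IsClosed C) : IsClosed (translateHull C A) :=
  isClosed_biInter fun u _ => hC.vadd u

end Topological

section LowerBoundTwo

variable {E : Type*} [NormedAddCommGroup E] [NormedSpace ℝ E] {C : Set E}

theorem eq_zero_of_forall_add_mem {d : E} (hC : Bornology.IsBounded C) (hne : C.Nonempty)
    (h : ∀ c ∈ C, c + d ∈ C) : d = 0 := by
  obtain ⟨c, hc⟩ := hne
  obtain ⟨R, hR⟩ := hC.exists_norm_le
  have multiples_mem (n : ℕ) : c + n • d ∈ C := by
    induction n with
    | zero => simpa using hc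
    | succ n ih => simpa only [succ_nsmul, add_assoc] using h _ ih
  by_contra hd
  obtain ⟨n, hn⟩ := exists_nat_gt ((R + ‖c‖) / ‖d‖)
  rw [div_lt_iff₀ (norm_pos_iff.2 hd)] at hn
  have upper : ‖n • d‖ ≤ R + ‖c‖ := by
    simpa using norm_sub_le_of_le (hR _ (multiples_mem n)) (le_refl ‖c‖)
  rw [← Nat.cast_smul_eq_nsmul ℝ, norm_smul, Real.norm_natCast] at upper
  exact hn.not_ge upper

theorem translateHull_singleton (hC : Bornology.IsBounded C) (hne : C.Nonempty) (x : E) :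
    translateHull C {x} = {x} := by
  refine subset_antisymm (fun p hp => ?_) subset_translateHull
  refine sub_eq_zero.1 (eq_zero_of_forall_add_mem hC hne fun c hc => ?_)
  have shift_mem : c - x ∈ shiftsInto {x} C := fun a ha => by
    rwa [mem_singleton_iff.1 ha, add_sub_cancel]
  simpa only [add_sub_left_comm] using mem_translateHull.1 hp _ shift_mem

theorem two_le_ballCaratheodoryNumber [Nontrivial E] (hC : Bornology.IsBounded C)
    (hne : C.Nonempty) (hconv : Convex ℝ C) : 2 ≤ ballCaratheodoryNumber C := by
  obtain ⟨y, hy⟩ := exists_ne (0 : E)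
  refine le_ballCaratheodoryNumber (k := 2) (V := {0, y}) (p := midpoint ℝ 0 y)
    (insert_nonempty 0 {y}) (toFinite _).isClosed ?_ fun W hWV hW hp => ?_
  · exact (convex_translateHull hconv).midpoint_mem (subset_translateHull (.inl rfl))
      (subset_translateHull (.inr rfl))
  obtain ⟨v, hv, hWv⟩ : ∃ v ∈ ({0, y} : Set E), W ⊆ {v} := by
    rcases (encard_le_one_iff_subsingleton.1 (Order.le_of_lt_succ hW)).eq_empty_or_singleton
      with rfl | ⟨v, rfl⟩
    · exact ⟨0, .inl rfl, empty_subset _⟩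
    · exact ⟨v, singleton_subset_iff.1 hWV, subset_rfl⟩
  have hpv : midpoint ℝ 0 y = v :=
    (translateHull_singleton hC hne v).subset (translateHull_mono hWv hp)
  rcases hv with rfl | rfl
  · exact hy ((midpoint_eq_left_iff ℝ).1 hpv).symm
  · exact hy ((midpoint_eq_right_iff ℝ).1 hpv).symm

end LowerBoundTwo

attribute [local instance] FiniteDimensional.of_fact_finrank_eq_two

section PlaneLinearAlgebra

variable {E : Type*} [AddCommGroup E] [Module ℝ E] [Fact (finrank ℝ E = 2)]
  {f g : E →ₗ[ℝ] ℝ} {d w x : E}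

theorem exists_basis_fin_two (hw : w ≠ 0) (hfw : f w = 0) (hfd : f d ≠ 0) :
    ∃ b : Basis (Fin 2) ℝ E, b 0 = w ∧ b 1 = d := by
  have hli : LinearIndependent ℝ ![w, d] := by
    refine (LinearIndependent.pair_iff' hw).2 fun a h => hfd ?_
    rw [← h, map_smul, hfw, smul_zero]
  exact ⟨basisOfLinearIndependentOfCardEqFinrank hli
    (by rw [Fintype.card_fin, Fact.out (p := finrank ℝ E = 2)]), by simp, by simp⟩

theorem exists_eq_smul_of_apply_eq_zero (hf : f ≠ 0) (hw : w ≠ 0) (hfw : f w = 0)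
    (hfx : f x = 0) : ∃ r : ℝ, x = r • w := by
  obtain ⟨d, hd⟩ := DFunLike.ne_iff.1 hf
  obtain ⟨b, rfl, rfl⟩ := exists_basis_fin_two hw hfw hd
  have hx := b.sum_repr x
  rw [Fin.sum_univ_two] at hx
  have h1 : b.repr x 1 = 0 := by
    rw [← hx] at hfx
    simpa [hfw, show f (b 1) ≠ 0 from hd] using hfx
  exact ⟨b.repr x 0, by simpa [h1] using hx.symm⟩

theorem exists_basis_coord_eq (hf : f ≠ 0) (hfd : f d = 0) (hgd : g d ≠ 0) :
    ∃ b : Basis (Fin 2) ℝ E, b.coord 0 = f ∧ b.coord 1 = g := by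
  obtain ⟨e, he⟩ := DFunLike.ne_iff.1 hf
  replace he : f e ≠ 0 := he
  have hd : d ≠ 0 := fun h => hgd (by rw [h, map_zero])
  obtain ⟨b, hb0, hb1⟩ := exists_basis_fin_two (f := f) (w := (g d)⁻¹ • d)
    (d := (f e)⁻¹ • (e - (g e / g d) • d)) (smul_ne_zero (inv_ne_zero hgd) hd)
    (by simp [hfd]) (by simp [hfd, he])
  refine ⟨b.reindex (Equiv.swap 0 1), b.ext (Fin.forall_fin_two.2 ⟨?_, ?_⟩),
    b.ext (Fin.forall_fin_two.2 ⟨?_, ?_⟩)⟩ <;>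
    rw [Basis.coord_apply, Basis.repr_reindex_apply, Basis.repr_self] <;>
    simp [hb0, hb1, hfd, hgd, he]

theorem exists_linearMap_apply_eq_zero (w : E) : ∃ f : E →ₗ[ℝ] ℝ, f ≠ 0 ∧ f w = 0 := by
  have hlt : Submodule.span ℝ {w} < ⊤ := span_lt_top_of_card_lt_finrank <| by
    rw [Fact.out (p := finrank ℝ E = 2), toFinset_singleton, Finset.card_singleton]
    exact one_lt_two
  obtain ⟨f, hf, hker⟩ := Submodule.exists_le_ker_of_lt_top _ hlt
  exact ⟨f, hf, (Submodule.span_singleton_le_iff_mem _ _).1 hker⟩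

theorem exists_ne_zero_apply_eq_zero (f : E →ₗ[ℝ] ℝ) : ∃ d ≠ 0, f d = 0 := by
  have hker : f.ker ≠ ⊥ := f.ker_ne_bot_of_finrank_lt <| by
    rw [Fact.out (p := finrank ℝ E = 2), finrank_self]
    exact one_lt_two
  obtain ⟨d, hd, hd0⟩ := Submodule.exists_mem_ne_zero_of_ne_bot hker
  exact ⟨d, hd0, hd⟩

theorem line_meets_segment_or (hw : w ≠ 0) (t y z : E) :
    (∃ r : ℝ, t + r • w ∈ segment ℝ y z) ∨
      ∃ l : ℝ, 0 < l ∧ ∃ τ : ℝ, y - t = l • (z - t) + τ • w := by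
  obtain ⟨f, hf, hfw⟩ := exists_linearMap_apply_eq_zero w
  by_cases ht : f t ∈ uIcc (f y) (f z)
  · rw [← segment_eq_uIcc, ← f.coe_toAffineMap, ← image_segment] at ht
    obtain ⟨x, hx, hfx⟩ := ht
    obtain ⟨r, hr⟩ := exists_eq_smul_of_apply_eq_zero (x := x - t) hf hw hfw
      (by simpa [sub_eq_zero] using hfx)
    exact .inl ⟨r, by rwa [← hr, add_sub_cancel]⟩
  · have same_side : 0 < f (y - t) / f (z - t) := by
      simp only [mem_uIcc, not_or, not_and, not_le, map_sub] at ht ⊢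
      rcases le_or_gt (f y) (f t) with hy | hy
      · exact div_pos_of_neg_of_neg (by grind) (by grind)
      · exact div_pos (by grind) (by grind)
    have hz : f (z - t) ≠ 0 := fun h => by simp [h] at same_side
    obtain ⟨τ, hτ⟩ := exists_eq_smul_of_apply_eq_zero
      (x := y - t - (f (y - t) / f (z - t)) • (z - t)) hf hw hfw
      (by rw [map_sub _ (y - t), map_smul, smul_eq_mul, div_mul_cancel₀ _ hz, sub_self])
    exact .inr ⟨_, same_side, τ, sub_eq_iff_eq_add'.1 hτ⟩

end PlaneLinearAlgebra

section ShiftedPoints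

variable {E : Type*} [AddCommGroup E] [Module ℝ E] {C : Set E} {t v w x y z : E} {r s l τ : ℝ}

theorem add_smul_mem_of_le (hC : Convex ℝ C) (hv : v ∈ C) (hr : v + r • w ∈ C) (hs : 0 ≤ s)
    (hsr : s ≤ r) : v + s • w ∈ C := by
  obtain rfl | hr0 := (hs.trans hsr).eq_or_lt
  · rwa [hsr.antisymm hs]
  · simpa only [smul_smul, div_mul_cancel₀ s hr0.ne'] using
      hC.add_smul_mem hv hr (t := s / r) ⟨by positivity, (div_le_one hr0).2 hsr⟩

theorem add_smul_sub_add_smul_sub_mem (hC : Convex ℝ C) (hx : x ∈ C) (hy : y ∈ C) (hz : z ∈ C)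
    (hr : 0 ≤ r) (hs : 0 ≤ s) (hrs : r + s ≤ 1) : x + r • (y - x) + s • (z - x) ∈ C := by
  have combination := hC.sum_mem (t := Finset.univ) (w := ![1 - r - s, r, s]) (z := ![x, y, z])
    (by intro i _; fin_cases i <;> simp <;> linarith)
    (by simp only [Fin.sum_univ_three, Matrix.cons_val]; ring)
    (by intro i _; fin_cases i <;> simpa)
  convert combination using 1
  simp only [Fin.sum_univ_three, Matrix.cons_val]
  module

theorem add_mem_of_ray_meets_segment (hC : Convex ℝ C) (hy : y ∈ C) (hz : z ∈ C) (ht : t ∈ C)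
    (hyw : y + w ∈ C) (hzw : z + w ∈ C) (hr : 0 ≤ r) (h : t + r • w ∈ segment ℝ y z) :
    t + w ∈ C := by
  have hrw : t + r • w ∈ C := hC.segment_subset hy hz h
  have hrw' : t + r • w + w ∈ C := by
    refine (hC.translate_preimage_left w).segment_subset ?_ ?_ h
    exacts [hyw, hzw]
  rcases le_total 1 r with hr1 | hr1
  · simpa using add_smul_mem_of_le hC ht hrw zero_le_one hr1
  · have hmem := add_smul_mem_of_le hC hrw (s := 1 - r) (r := 1) (by rwa [one_smul])
      (sub_nonneg.2 hr1) (by linarith)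
    rwa [add_assoc, ← add_smul, add_sub_cancel, one_smul] at hmem

theorem exists_add_smul_sub_mem (hC : Convex ℝ C) (hz : z ∈ C) (ht : t ∈ C) (hzw : z + w ∈ C)
    (hl : 0 < l) (hτ : τ ≤ 0) (h : y - t = l • (z - t) + τ • w) :
    ∃ s ∈ Ioc (0 : ℝ) 1, z + s • (t - y) ∈ C := by
  set s := (1 + l - τ)⁻¹
  have hpos : 0 < 1 + l - τ := by linarith
  have hs0 : 0 < s := inv_pos.2 hpos
  have hsum : s * (1 + l - τ) = 1 := inv_mul_cancel₀ hpos.ne'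
  refine ⟨s, ⟨hs0, inv_le_one_of_one_le₀ (by linarith)⟩, ?_⟩
  have hmem := add_smul_sub_add_smul_sub_mem hC hz ht hzw (r := s * l) (s := s * -τ)
    (by positivity) (mul_nonneg hs0.le (by linarith)) (by linarith)
  have hty : t - y = l • (t - z) + -τ • w := by
    rw [← neg_sub y t, h]
    module
  convert hmem using 1
  rw [hty]
  module

end ShiftedPoints

section TopPoints

variable {E : Type*} [AddCommGroup E] [Module ℝ E] [Fact (finrank ℝ E = 2)] {C : Set E}
  {n : E →ₗ[ℝ] ℝ} {q t v v₀ y z : E}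

theorem mem_spindle_of_forall_apply_nonpos (hC : Convex ℝ C) (hy : y ∈ C) (hz : z ∈ C)
    (ht : t ∈ C) (hny : n y < n t) (hnz : n z < n t)
    (h : ∀ w ∈ shiftsInto {y, z} C, n w ≤ 0) : t ∈ spindle C y z := by
  refine mem_spindle.2 fun w hyw hzw => ?_
  obtain rfl | hw := eq_or_ne w 0
  · rwa [add_zero]
  have hnw : n w ≤ 0 := h w (shiftsInto_pair_iff.2 ⟨hyw, hzw⟩)
  rcases line_meets_segment_or hw t y z with ⟨r, hr⟩ | ⟨l, hl, τ, hτ⟩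
  · refine add_mem_of_ray_meets_segment hC hy hz ht hyw hzw ?_ hr
    have below : n (t + r • w) < n t :=
      (convex_halfSpace_lt n.isLinear (n t)).segment_subset hny hnz hr
    rw [map_add, map_smul, smul_eq_mul] at below
    nlinarith
  · exfalso
    have no_raise {s : ℝ} {x : E} (hs : 0 < s) (hx : n x < n t) :
        s • (t - x) ∉ shiftsInto {y, z} C := fun hmem => by
      have hle := h _ hmem
      rw [map_smul, map_sub, smul_eq_mul] at hle
      nlinarith
    rcases le_total τ 0 with hτ0 | hτ0
    · obtain ⟨s, hs, hmem⟩ := exists_add_smul_sub_mem hC hz ht hzw hl hτ0 hτ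
      exact no_raise hs.1 hny <| shiftsInto_pair_iff.2
        ⟨hC.add_smul_sub_mem hy ht ⟨hs.1.le, hs.2⟩, hmem⟩
    · have hτ' : z - t = l⁻¹ • (y - t) + (-(l⁻¹ * τ)) • w := by
        rw [hτ, smul_add, inv_smul_smul₀ hl.ne']
        module
      obtain ⟨s, hs, hmem⟩ := exists_add_smul_sub_mem hC hy ht hyw (inv_pos.2 hl)
        (neg_nonpos.2 (by positivity)) hτ'
      exact no_raise hs.1 hnz <| shiftsInto_pair_iff.2
        ⟨hmem, hC.add_smul_sub_mem hz ht ⟨hs.1.le, hs.2⟩⟩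

theorem exists_add_smul_mem_of_notMem_spindle (hC : Convex ℝ C) (hn : n ≠ 0)
    (htop : ∀ x ∈ C, n x ≤ n q) (hv₀ : v₀ ∈ C) (hv₀q : n v₀ = n q) (hq : q ∈ C) (hv : v ∈ C)
    (h : q ∉ spindle C v₀ v) : ∃ s : ℝ, 0 < s ∧ v + s • (q - v₀) ∈ C := by
  simp only [mem_spindle, not_forall] at h
  obtain ⟨w, hv₀w, hvw, hqw⟩ := h
  have hw : w ≠ 0 := by
    rintro rfl
    exact hqw (by rwa [add_zero])
  have hnw : n w ≤ 0 := by
    have := htop _ hv₀w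
    rw [map_add, hv₀q] at this
    linarith
  have hqv₀ : q - v₀ ≠ 0 := fun heq => hqw (sub_eq_zero.1 heq ▸ hv₀w)
  rcases hnw.lt_or_eq with hnw | hnw
  · rcases line_meets_segment_or hw q v₀ v with ⟨r, hr⟩ | ⟨l, hl, τ, hτ⟩
    · refine (hqw (add_mem_of_ray_meets_segment hC hv₀ hv hq hv₀w hvw ?_ hr)).elim
      have hle := htop _ (hC.segment_subset hv₀ hv hr)
      rw [map_add, map_smul, smul_eq_mul] at hle
      nlinarith
    · have hτ0 : τ ≤ 0 := by
        have hn' := congrArg n hτ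
        simp only [map_sub, map_add, map_smul, smul_eq_mul] at hn'
        nlinarith [htop v hv]
      obtain ⟨s, hs, hmem⟩ := exists_add_smul_sub_mem hC hv hq hvw hl hτ0 hτ
      exact ⟨s, hs.1, hmem⟩
  · obtain ⟨r, rfl⟩ := exists_eq_smul_of_apply_eq_zero hn hqv₀ (by simp [hv₀q]) hnw
    refine ⟨r, ?_, hvw⟩
    by_contra! hr
    have hmem := add_smul_mem_of_le hC hv₀w (w := q - v₀) (r := 1 - r) (s := 1) ?_ zero_le_one
      (by linarith)
    · exact hqw (by convert hmem using 1; module)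
    · convert hq using 1
      module

end TopPoints

section Stability

variable {E : Type*} [NormedAddCommGroup E] [NormedSpace ℝ E] {C : Set E} {f : StrongDual ℝ E}
  {v w x : E} {s u : ℝ}

theorem apply_lt_of_mem_interior (hf : f ≠ 0) (h : ∀ y ∈ C, f y ≤ u) (hx : x ∈ interior C) :
    f x < u := by
  have hfx := (f.isOpenMap_of_ne_zero hf).mapsTo_interior (t := Iic u) h hx
  rwa [interior_Iic] at hfx

variable [Fact (finrank ℝ E = 2)]

theorem eventually_add_smul_mem_of_apply_eq_zero (hC : Convex ℝ C) (hi : (interior C).Nonempty)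
    (hv : v ∈ C) (hvw : v + w ∈ C) (hf : f ≠ 0) (hfC : ∀ y ∈ C, f y ≤ f v) (hfw : f w = 0)
    (hs0 : 0 < s) (hs1 : s < 1) : ∀ᶠ v' in 𝓝[C] v, v' + s • w ∈ C := by
  obtain rfl | hw := eq_or_ne w 0
  · simpa using eventually_mem_nhdsWithin
  obtain ⟨c, hc⟩ := hi
  have hfc : f (c - v) < 0 := by
    rw [map_sub, sub_neg]
    exact apply_lt_of_mem_interior hf hfC hc
  obtain ⟨b, hb0, hb1⟩ := exists_basis_fin_two (f := f.toLinearMap) hw hfw hfc.ne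
  have coord_continuous (i : Fin 2) : Continuous fun v' => b.coord i (v' - v) :=
    (b.coord i).continuous_of_finiteDimensional.comp (continuous_id.sub continuous_const)
  have coord_pos : ∀ᶠ v' in 𝓝[C] v, 0 < s + b.coord 0 (v' - v) :=
    nhdsWithin_le_nhds <| ((coord_continuous 0).const_add s).continuousAt.eventually
      (lt_mem_nhds (by simpa using hs0))
  have coord_sum_lt : ∀ᶠ v' in 𝓝[C] v, s + b.coord 0 (v' - v) + b.coord 1 (v' - v) < 1 :=
    nhdsWithin_le_nhds <| (((coord_continuous 0).const_add s).add
      (coord_continuous 1)).continuousAt.eventually (gt_mem_nhds (by simpa using hs1))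
  filter_upwards [coord_pos, coord_sum_lt, eventually_mem_nhdsWithin] with v' hpos hlt hv'
  have hsum : v' - v = b.coord 0 (v' - v) • w + b.coord 1 (v' - v) • (c - v) := by
    simpa only [Fin.sum_univ_two, hb0, hb1, Basis.coord_apply] using (b.sum_repr (v' - v)).symm
  have hnonneg : 0 ≤ b.coord 1 (v' - v) := by
    have hf' := congrArg f hsum
    rw [map_sub, map_add, map_smul, map_smul, hfw, smul_zero, zero_add, smul_eq_mul] at hf'
    nlinarith [hfC v' hv']
  convert add_smul_sub_add_smul_sub_mem hC hv hvw (interior_subset hc) hpos.le hnonneg hlt.le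
    using 1
  conv_lhs => rw [← sub_add_cancel v' v, hsum]
  module

theorem eventually_add_smul_mem (hC : Convex ℝ C) (hi : (interior C).Nonempty) (hv : v ∈ C)
    (hvw : v + w ∈ C) (hs0 : 0 < s) (hs1 : s < 1) : ∀ᶠ v' in 𝓝[C] v, v' + s • w ∈ C := by
  by_cases hint : v + s • w ∈ interior C
  · have shift_tendsto : Tendsto (· + s • w) (𝓝[C] v) (𝓝 (v + s • w)) :=
      (continuous_add_const _).continuousAt.tendsto.mono_left nhdsWithin_le_nhds
    exact shift_tendsto.eventually (mem_interior_iff_mem_nhds.1 hint)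
  obtain ⟨f, hf, hfC⟩ := geometric_hahn_banach_of_nonempty_interior_point hC hint hi
  have hfw : f w = 0 := by
    have hfv := hfC v hv
    have hfvw := hfC _ hvw
    simp only [map_add, map_smul, smul_eq_mul] at hfv hfvw
    nlinarith
  refine eventually_add_smul_mem_of_apply_eq_zero hC hi hv hvw hf ?_ hfw hs0 hs1
  simpa [hfw] using hfC

end Stability

section CommonShift

variable {E : Type*} [NormedAddCommGroup E] [NormedSpace ℝ E] [Fact (finrank ℝ E = 2)]
  {C D V : Set E}

theorem exists_finset_serving_pairs (hC : Convex ℝ C) (hi : (interior C).Nonempty)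
    (hV : IsCompact V) (hVC : V ⊆ C) (hD : ∀ w ∈ D, (1 / 2 : ℝ) • w ∈ D)
    (h : ∀ y ∈ V, ∀ z ∈ V, (D ∩ shiftsInto {y, z} C).Nonempty) :
    ∃ X : Finset E, ↑X ⊆ D ∧ ∀ y ∈ V, ∀ z ∈ V, (↑X ∩ shiftsInto {y, z} C).Nonempty := by
  classical
  suffices ∃ X : Finset E, ↑X ⊆ D ∧ ∀ q ∈ V ×ˢ V, (↑X ∩ shiftsInto {q.1, q.2} C).Nonempty by
    obtain ⟨X, hXD, hX⟩ := this
    exact ⟨X, hXD, fun y hy z hz => hX (y, z) ⟨hy, hz⟩⟩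
  refine (hV.prod hV).induction_on
    (p := fun S => ∃ X : Finset E, ↑X ⊆ D ∧ ∀ q ∈ S, (↑X ∩ shiftsInto {q.1, q.2} C).Nonempty)
    ⟨∅, by simp⟩ ?_ ?_ ?_
  · rintro S T hST ⟨X, hXD, hX⟩
    exact ⟨X, hXD, fun q hq => hX q (hST hq)⟩
  · rintro S T ⟨X, hXD, hX⟩ ⟨Y, hYD, hY⟩
    refine ⟨X ∪ Y, by simp [hXD, hYD], ?_⟩
    rintro q (hq | hq)
    · exact (hX q hq).mono (inter_subset_inter_left _ (by simp))
    · exact (hY q hq).mono (inter_subset_inter_left _ (by simp))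
  · rintro ⟨y, z⟩ ⟨hy, hz⟩
    obtain ⟨w, hwD, hw⟩ := h y hy z hz
    rw [shiftsInto_pair_iff] at hw
    have stable {v : E} (hv : v ∈ V) (hvw : v + w ∈ C) :
        ∀ᶠ v' in 𝓝[V] v, v' + (1 / 2 : ℝ) • w ∈ C :=
      nhdsWithin_mono v hVC
        (eventually_add_smul_mem hC hi (hVC hv) hvw one_half_pos one_half_lt_one)
    refine ⟨{q | q.1 + (1 / 2 : ℝ) • w ∈ C ∧ q.2 + (1 / 2 : ℝ) • w ∈ C}, ?_, {(1 / 2 : ℝ) • w},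
      by simpa using hD w hwD, fun q hq => ⟨_, by simp, shiftsInto_pair_iff.2 hq⟩⟩
    rw [nhdsWithin_prod_eq]
    exact (stable hy hw.1).prod_mk (stable hz hw.2)

theorem exists_pair_of_card_le_two {α : Type*} [Nonempty α] {I : Finset α} (hI : I.card ≤ 2) :
    ∃ a b, ∀ i ∈ I, i = a ∨ i = b := by
  classical
  obtain h | h | h : I.card = 0 ∨ I.card = 1 ∨ I.card = 2 := by omega
  · exact ⟨Classical.arbitrary α, Classical.arbitrary α, by simp [Finset.card_eq_zero.1 h]⟩
  · obtain ⟨a, rfl⟩ := Finset.card_eq_one.1 h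
    exact ⟨a, a, by simp⟩
  · obtain ⟨a, b, -, rfl⟩ := Finset.card_eq_two.1 h
    exact ⟨a, b, by simp⟩

theorem inter_shiftsInto_nonempty (hC : IsConvexBody C) (hV : IsCompact V)
    (hVne : V.Nonempty) (hVC : V ⊆ C) (hD : Convex ℝ D) (hDhalf : ∀ w ∈ D, (1 / 2 : ℝ) • w ∈ D)
    (h : ∀ y ∈ V, ∀ z ∈ V, (D ∩ shiftsInto {y, z} C).Nonempty) :
    (D ∩ shiftsInto V C).Nonempty := by
  classical
  obtain ⟨hCcomp, hCconv, hCi⟩ := hC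
  obtain ⟨X, hXD, hX⟩ := exists_finset_serving_pairs hCconv hCi hV hVC hDhalf h
  have : Nonempty V := hVne.to_subtype
  let F : Option V → Set E := fun i => i.elim (convexHull ℝ ↑X) fun v => shiftsInto {v.1} C
  have common : (⋂ i, F i).Nonempty := by
    refine Convex.helly_theorem_compact' (𝕜 := ℝ) ?_ ?_ fun I hI => ?_
    · rintro (_ | v)
      exacts [convex_convexHull ℝ _, convex_shiftsInto hCconv]
    · rintro (_ | v)
      exacts [X.finite_toSet.isCompact_convexHull ℝ,
        isCompact_shiftsInto hCcomp (singleton_nonempty _)]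
    by_cases hnone : none ∈ I
    · have hcard : I.eraseNone.card ≤ 2 := by
        rw [Fact.out (p := finrank ℝ E = 2)] at hI
        rw [Finset.card_eraseNone_of_mem hnone]
        omega
      obtain ⟨y, z, hyz⟩ := exists_pair_of_card_le_two hcard
      obtain ⟨w, hwX, hw⟩ := hX y y.2 z z.2
      refine ⟨w, mem_iInter₂.2 ?_⟩
      rintro (_ | v) hv
      · exact subset_convexHull ℝ _ hwX
      · refine shiftsInto_anti_left (singleton_subset_iff.2 ?_) hw
        exact (hyz v (Finset.mem_eraseNone.2 hv)).imp (congrArg _) (congrArg _)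
    · refine ⟨0, mem_iInter₂.2 ?_⟩
      rintro (_ | v) hv
      · exact (hnone hv).elim
      · rintro _ rfl
        simpa using hVC v.2
  obtain ⟨w, hw⟩ := common
  rw [mem_iInter] at hw
  exact ⟨w, convexHull_min hXD hD (hw none), fun v hv => hw (some ⟨v, hv⟩) v rfl⟩

end CommonShift

section SupportingFunctionals

variable {E : Type*} [NormedAddCommGroup E] [NormedSpace ℝ E] {C V : Set E}

theorem IsConvexBody.vadd (hC : IsConvexBody C) (u : E) : IsConvexBody (u +ᵥ C) :=
  ⟨hC.1.vadd u, hC.2.1.vadd u, by rw [interior_vadd]; exact hC.2.2.vadd_set⟩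

variable [Fact (finrank ℝ E = 2)] {n : E →ₗ[ℝ] ℝ} {q v₀ : E}

theorem exists_mem_spindle_of_forall_lt (hC : IsConvexBody C) (hV : IsCompact V)
    (hVne : V.Nonempty) (hVC : V ⊆ C) (hq : q ∈ C) (htop : ∀ x ∈ C, n x ≤ n q)
    (hqV : q ∈ translateHull C V) (hlt : ∀ v ∈ V, n v < n q) :
    ∃ y ∈ V, ∃ z ∈ V, q ∈ spindle C y z := by
  by_contra! hpair
  have pair_raisable : ∀ y ∈ V, ∀ z ∈ V, ({w | 0 < n w} ∩ shiftsInto {y, z} C).Nonempty := by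
    intro y hy z hz
    by_contra! hempty
    refine hpair y hy z hz (mem_spindle_of_forall_apply_nonpos hC.2.1 (hVC hy) (hVC hz) hq
      (hlt y hy) (hlt z hz) fun w hw => ?_)
    by_contra! hnw
    exact hempty.subset ⟨hnw, hw⟩
  obtain ⟨w, hnw, hw⟩ := inter_shiftsInto_nonempty hC hV hVne hVC
    (convex_halfSpace_gt n.isLinear 0) (fun w (hw : 0 < n w) => by simpa using hw) pair_raisable
  have hle := htop _ (mem_translateHull.1 hqV w hw)
  rw [map_add] at hle
  exact (lt_add_of_pos_right (n q) hnw).not_ge hle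

theorem exists_mem_spindle_of_no_shift_along (hC : IsConvexBody C) (hV : IsCompact V)
    (hVC : V ⊆ C) (hn : n ≠ 0) (hq : q ∈ C) (htop : ∀ x ∈ C, n x ≤ n q) (hv₀ : v₀ ∈ V)
    (hv₀q : n v₀ = n q) (hno : ∀ s : ℝ, 0 < s → s • (q - v₀) ∉ shiftsInto V C) :
    ∃ v ∈ V, q ∈ spindle C v₀ v := by
  by_contra! hpair
  set D : Set E := LinearMap.toSpanSingleton ℝ E (q - v₀) '' Ioi 0
  have mem_D {s : ℝ} (hs : 0 < s) : s • (q - v₀) ∈ D := ⟨s, hs, rfl⟩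
  have shift {v : E} (hv : v ∈ V) : ∃ s : ℝ, 0 < s ∧ v + s • (q - v₀) ∈ C :=
    exists_add_smul_mem_of_notMem_spindle hC.2.1 hn htop (hVC hv₀) hv₀q hq (hVC hv) (hpair v hv)
  have halving : ∀ w ∈ D, (1 / 2 : ℝ) • w ∈ D := by
    rintro _ ⟨s, hs, rfl⟩
    rw [LinearMap.toSpanSingleton_apply, smul_smul]
    exact mem_D (mul_pos one_half_pos hs)
  have pair_shiftable : ∀ y ∈ V, ∀ z ∈ V, (D ∩ shiftsInto {y, z} C).Nonempty := by
    intro y hy z hz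
    obtain ⟨r, hr, hyr⟩ := shift hy
    obtain ⟨s, hs, hzs⟩ := shift hz
    exact ⟨min r s • (q - v₀), mem_D (lt_min hr hs), shiftsInto_pair_iff.2
      ⟨add_smul_mem_of_le hC.2.1 (hVC hy) hyr (le_min hr.le hs.le) (min_le_left r s),
        add_smul_mem_of_le hC.2.1 (hVC hz) hzs (le_min hr.le hs.le) (min_le_right r s)⟩⟩
  obtain ⟨_, ⟨s, hs, rfl⟩, hsV⟩ := inter_shiftsInto_nonempty hC hV ⟨v₀, hv₀⟩ hVC
    ((convex_Ioi 0).linear_image _) halving pair_shiftable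
  exact hno s hs hsV

theorem exists_mem_spindle_of_apply_eq (hC : IsConvexBody C) (hV : IsCompact V) (hVC : V ⊆ C)
    (hn : n ≠ 0) (htop : ∀ x ∈ C, n x ≤ n q) (hqV : q ∈ translateHull C V)
    (hv₀ : v₀ ∈ V) (hv₀q : n v₀ = n q) : ∃ v ∈ V, q ∈ spindle C v₀ v := by
  obtain rfl | hne := eq_or_ne q v₀
  · exact ⟨q, hv₀, subset_translateHull (.inl rfl)⟩
  -- Slide `C` backwards along the edge direction as far as it still contains `V`.
  have shifts_compact : IsCompact {s : ℝ | s • (q - v₀) ∈ shiftsInto V C} :=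
    (isClosedEmbedding_smul_left (sub_ne_zero.2 hne)).isCompact_preimage
      (isCompact_shiftsInto hC.1 ⟨v₀, hv₀⟩)
  obtain ⟨s, hs, hmax⟩ := shifts_compact.exists_isGreatest
    ⟨0, fun v hv => by simpa using hVC hv⟩
  set C' := -(s • (q - v₀)) +ᵥ C with hC'
  have mem_C' {x : E} : x ∈ C' ↔ x + s • (q - v₀) ∈ C := by
    rw [hC', mem_vadd_set_iff_neg_vadd_mem, neg_neg, vadd_eq_add, add_comm]
  have hVC' : V ⊆ C' := fun v hv => mem_C'.2 (hs v hv)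
  have hqV' : q ∈ translateHull C' V := by rwa [translateHull_vadd]
  have hqC' : q ∈ C' := by
    simpa using mem_translateHull.1 hqV' 0 fun v hv => by simpa using hVC' hv
  have htop' : ∀ x ∈ C', n x ≤ n q := fun x hx => by
    simpa [hv₀q] using htop _ (mem_C'.1 hx)
  have no_further_shift : ∀ r : ℝ, 0 < r → r • (q - v₀) ∉ shiftsInto V C' := fun r hr hrV => by
    have hle : r + s ≤ s := hmax fun v hv => by
      simpa only [add_smul, add_assoc] using mem_C'.1 (hrV v hv)
    linarith
  obtain ⟨v, hv, hqv⟩ := exists_mem_spindle_of_no_shift_along (hC.vadd _) hV hVC' hn hqC' htop'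
    hv₀ hv₀q no_further_shift
  exact ⟨v, hv, by rwa [spindle, translateHull_vadd] at hqv⟩

theorem exists_mem_spindle_of_mem_translateHull (hC : IsConvexBody C) (hV : IsCompact V)
    (hVne : V.Nonempty) (hVC : V ⊆ C) (hn : n ≠ 0) (hq : q ∈ C) (htop : ∀ x ∈ C, n x ≤ n q)
    (hqV : q ∈ translateHull C V) : ∃ y ∈ V, ∃ z ∈ V, q ∈ spindle C y z := by
  by_cases h : ∃ v ∈ V, n v = n q
  · obtain ⟨v₀, hv₀, hv₀q⟩ := h
    exact ⟨v₀, hv₀, exists_mem_spindle_of_apply_eq hC hV hVC hn htop hqV hv₀ hv₀q⟩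
  · push Not at h
    exact exists_mem_spindle_of_forall_lt hC hV hVne hVC hq htop hqV fun v hv =>
      (htop v (hVC hv)).lt_of_ne (h v hv)

end SupportingFunctionals

section UpperBoundThree

variable {E : Type*} [NormedAddCommGroup E] {C H V : Set E} {p q v : E}

theorem mem_interior_translateHull (hC : IsCompact C) (hV : V.Nonempty)
    (h : ∀ w ∈ shiftsInto V C, q + w ∈ interior C) : q ∈ interior (translateHull C V) := by
  have stable : ∀ w ∈ shiftsInto V C, ∀ᶠ z : E × E in 𝓝 (q, w), z.1 + z.2 ∈ C := fun w hw =>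
    (continuous_fst.add continuous_snd).continuousAt.eventually
      (mem_interior_iff_mem_nhds.1 (h w hw))
  refine mem_interior_iff_mem_nhds.2 <| mem_of_superset
    ((isCompact_shiftsInto hC hV).eventually_forall_of_forall_eventually
      (P := fun x w => x + w ∈ C) stable) fun x hx => mem_translateHull.2 hx

variable [NormedSpace ℝ E]

theorem exists_notMem_interior_mem_segment (hH : IsCompact H) (hv : v ∈ H) (hp : p ∈ H)
    (hne : p ≠ v) :
    ∃ q ∈ H, q ∉ interior H ∧ p ∈ segment ℝ v q := by
  have hd : p - v ≠ 0 := sub_ne_zero.2 hne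
  have ray_compact : IsCompact {s : ℝ | v + s • (p - v) ∈ H} :=
    ((Homeomorph.addLeft v).isClosedEmbedding.comp
      (isClosedEmbedding_smul_left hd)).isCompact_preimage hH
  obtain ⟨s, hs, hmax⟩ := ray_compact.exists_isGreatest ⟨0, by simpa using hv⟩
  have one_le : 1 ≤ s := hmax (by simpa using hp)
  refine ⟨v + s • (p - v), hs, fun hint => ?_, ?_⟩
  · have ray_continuous : Continuous fun r : ℝ => v + r • (p - v) := by fun_prop
    have further : ∀ᶠ r in 𝓝[>] s, v + r • (p - v) ∈ H :=
      nhdsWithin_le_nhds <|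
        ray_continuous.continuousAt.eventually (mem_interior_iff_mem_nhds.1 hint)
    obtain ⟨r, hr, hsr⟩ := (further.and eventually_mem_nhdsWithin).exists
    exact (hmax hr).not_gt hsr
  · simpa using add_smul_mem_of_le (convex_segment v _) (left_mem_segment ℝ v _)
      (right_mem_segment ℝ v (v + s • (p - v))) zero_le_one one_le

theorem exists_encard_le_shiftsInto_eq_empty [FiniteDimensional ℝ E] (hC : IsCompact C)
    (hconv : Convex ℝ C) (h : shiftsInto V C = ∅) :
    ∃ W ⊆ V, W.encard ≤ finrank ℝ E + 1 ∧ shiftsInto W C = ∅ := by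
  by_contra! hne
  have common : (⋂ v : V, shiftsInto {v.1} C).Nonempty := by
    refine Convex.helly_theorem_compact' (𝕜 := ℝ) (fun v => convex_shiftsInto hconv)
      (fun v => isCompact_shiftsInto hC (singleton_nonempty _)) fun I hI => ?_
    obtain ⟨w, hw⟩ := hne (Subtype.val '' (I : Set V)) (Subtype.coe_image_subset _ _) <|
      (encard_image_le _ _).trans (by rw [encard_coe_eq_coe_finsetCard]; exact_mod_cast hI)
    exact ⟨w, mem_iInter₂.2 fun v hv => shiftsInto_anti_left
      (singleton_subset_iff.2 (mem_image_of_mem _ hv)) hw⟩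
  obtain ⟨w, hw⟩ := common
  exact h.subset fun v hv => mem_iInter.1 hw ⟨v, hv⟩ v rfl

variable [Fact (finrank ℝ E = 2)]

theorem exists_mem_spindle_of_notMem_interior (hC : IsConvexBody C) (hV : IsCompact V)
    (hVne : V.Nonempty) (hq : q ∈ translateHull C V) (hqi : q ∉ interior (translateHull C V)) :
    ∃ y ∈ V, ∃ z ∈ V, q ∈ spindle C y z := by
  obtain ⟨w, hw, hwi⟩ : ∃ w ∈ shiftsInto V C, q + w ∉ interior C := by
    by_contra! h
    exact hqi (mem_interior_translateHull hC.1 hVne h)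
  obtain ⟨n, hn, hnC⟩ := geometric_hahn_banach_of_nonempty_interior_point hC.2.1 hwi hC.2.2
  have mem_vadd {x : E} : x ∈ -w +ᵥ C ↔ x + w ∈ C := by
    rw [mem_vadd_set_iff_neg_vadd_mem, neg_neg, vadd_eq_add, add_comm]
  obtain ⟨y, hy, z, hz, hyz⟩ := exists_mem_spindle_of_mem_translateHull (n := n.toLinearMap)
    (hC.vadd (-w)) hV hVne (subset_neg_vadd_iff.2 hw)
    (fun h => hn (ContinuousLinearMap.coe_injective h)) (mem_vadd.2 (mem_translateHull.1 hq w hw))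
    (fun x hx => by simpa using hnC _ (mem_vadd.1 hx)) (by rwa [translateHull_vadd])
  exact ⟨y, hy, z, hz, by rwa [spindle, translateHull_vadd] at hyz⟩

theorem exists_encard_le_three (hC : IsConvexBody C) (hVne : V.Nonempty) (hV : IsClosed V)
    (hp : p ∈ translateHull C V) : ∃ W ⊆ V, W.encard ≤ 3 ∧ p ∈ translateHull C W := by
  obtain ⟨hCcomp, hCconv, -⟩ := id hC
  rcases (shiftsInto V C).eq_empty_or_nonempty with hempty | ⟨w, hw⟩
  · obtain ⟨W, hWV, hWcard, hW⟩ := exists_encard_le_shiftsInto_eq_empty hCcomp hCconv hempty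
    rw [Fact.out (p := finrank ℝ E = 2)] at hWcard
    exact ⟨W, hWV, hWcard.trans_eq (by norm_num),
      (translateHull_eq_univ hW).symm ▸ mem_univ p⟩
  have hVcomp : IsCompact V :=
    (hCcomp.vadd (-w)).of_isClosed_subset hV (subset_neg_vadd_iff.2 hw)
  have hull_compact : IsCompact (translateHull C V) :=
    (hCcomp.vadd (-w)).of_isClosed_subset (isClosed_translateHull hCcomp.isClosed)
      (biInter_subset_of_mem (subset_neg_vadd_iff.2 hw))
  obtain ⟨v, hv⟩ := hVne
  obtain rfl | hne := eq_or_ne p v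
  · exact ⟨{p}, singleton_subset_iff.2 hv, by simp, subset_translateHull rfl⟩
  obtain ⟨q, hq, hqi, hpq⟩ := exists_notMem_interior_mem_segment hull_compact
    (subset_translateHull hv) hp hne
  obtain ⟨y, hy, z, hz, hyz⟩ := exists_mem_spindle_of_notMem_interior hC hVcomp ⟨v, hv⟩ hq hqi
  have card_le : ({v, y, z} : Set E).encard ≤ 3 := by
    grw [encard_insert_le, encard_insert_le, encard_singleton]
    norm_num
  refine ⟨{v, y, z}, by simp [insert_subset_iff, hv, hy, hz], card_le, ?_⟩
  exact (convex_translateHull hCconv).segment_subset (subset_translateHull (.inl rfl))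
    (translateHull_mono (subset_insert v {y, z}) hyz) hpq

theorem ballCaratheodoryNumber_le_three (hC : IsConvexBody C) : ballCaratheodoryNumber C ≤ 3 :=
  ballCaratheodoryNumber_le three_pos fun _ hVne hV _ hp => exists_encard_le_three hC hVne hV hp

end UpperBoundThree

section ExposedPoints

variable {E : Type*} [NormedAddCommGroup E] [NormedSpace ℝ E] [FiniteDimensional ℝ E]
  {S : Set E} {f : StrongDual ℝ E}

theorem exists_mem_nhds_unique_maximizer (hS : IsCompact S) (hne : S.Nonempty)
    {U : Set (StrongDual ℝ E)} (hU : U ∈ 𝓝 f) :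
    ∃ g ∈ U, ∃ t ∈ S, ∀ x ∈ S, x ≠ t → g x < g t := by
  let L : E ≃L[ℝ] EuclideanSpace ℝ (Fin (finrank ℝ E)) := toEuclidean
  let g (ε : ℝ) (t : E) : StrongDual ℝ E := f + ε • (innerSL ℝ (L t)).comp L.toContinuousLinearMap
  have g_continuous : Continuous fun z : ℝ × E => g z.1 z.2 := by
    fun_prop
  have near : ∀ᶠ ε in 𝓝[>] (0 : ℝ), ∀ t ∈ S, g ε t ∈ U :=
    nhdsWithin_le_nhds <| hS.eventually_forall_of_forall_eventually fun t _ =>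
      g_continuous.continuousAt.eventually (by simpa [g] using hU)
  obtain ⟨ε, hgU, hε : 0 < ε⟩ := (near.and eventually_mem_nhdsWithin).exists
  have perturbation_continuous : Continuous fun x => f x + ε / 2 * ‖L x‖ ^ 2 := by fun_prop
  obtain ⟨t, ht, hmax⟩ := hS.exists_isMaxOn hne perturbation_continuous.continuousOn
  refine ⟨g ε t, hgU t ht, t, ht, fun x hx hxt => ?_⟩
  have hle : f x + ε / 2 * ‖L x‖ ^ 2 ≤ f t + ε / 2 * ‖L t‖ ^ 2 := hmax hx
  have gap : 0 < ε / 2 * ‖L x - L t‖ ^ 2 := by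
    have := norm_pos_iff.2 (sub_ne_zero.2 (L.injective.ne hxt))
    positivity
  rw [norm_sub_sq_real, real_inner_comm] at gap
  simp only [g, add_apply, smul_apply, smul_eq_mul,
    ContinuousLinearMap.comp_apply, ContinuousLinearEquiv.coe_coe, innerSL_apply_apply,
    real_inner_self_eq_norm_sq]
  linarith

end ExposedPoints

section SpindleConvexity

variable {E : Type*} [NormedAddCommGroup E] {C K : Set E} {t x y z : E}

theorem IsSpindleConvex.convex [NormedSpace ℝ E] (hC : Convex ℝ C) (hs : IsSpindleConvex C K) :
    Convex ℝ K :=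
  convex_iff_segment_subset.2 fun _ hy _ hz =>
    ((convex_translateHull hC).segment_subset (subset_translateHull (.inl rfl))
      (subset_translateHull (.inr rfl))).trans (hs _ hy _ hz)

theorem IsSpindleConvex.nonempty_shiftsInto_pair (hs : IsSpindleConvex C K) (hK : K ≠ univ)
    (hy : y ∈ K) (hz : z ∈ K) : (shiftsInto {y, z} C).Nonempty := by
  by_contra! h
  exact hK (univ_subset_iff.1 (translateHull_eq_univ h ▸ hs y hy z hz))

theorem IsSpindleConvex.isBounded (hC : Bornology.IsBounded C) (hs : IsSpindleConvex C K)
    (hK : K ≠ univ) : Bornology.IsBounded K := by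
  obtain rfl | ⟨y, hy⟩ := K.eq_empty_or_nonempty
  · exact Bornology.isBounded_empty
  refine ((hC.sub hC).vadd y).subset fun z hz => ?_
  obtain ⟨w, hw⟩ := hs.nonempty_shiftsInto_pair hK hy hz
  rw [shiftsInto_pair_iff] at hw
  exact ⟨_, ⟨_, hw.2, _, hw.1, rfl⟩, by simp⟩

variable [NormedSpace ℝ E] [Fact (finrank ℝ E = 2)] {f : StrongDual ℝ E}

theorem IsSpindleConvex.add_sub_mem (hC : IsConvexBody C) (hs : IsSpindleConvex C K)
    (hK : K ≠ univ) (ht : t ∈ C) (htop : ∀ z ∈ C, z ≠ t → f z < f t) (hx : x ∈ K)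
    (hxmax : ∀ z ∈ K, f z ≤ f x) (hy : y ∈ K) : y + (t - x) ∈ C := by
  obtain ⟨w, hw, hwmax⟩ := (isCompact_shiftsInto hC.1 (insert_nonempty x {y})).exists_isMaxOn
    (hs.nonempty_shiftsInto_pair hK hx hy) f.continuous.continuousOn
  obtain ⟨hxw, hyw⟩ := shiftsInto_pair_iff.1 hw
  suffices x + w = t by rwa [← this, add_sub_cancel_left]
  by_contra hne
  have hxt : f (x + w) < f t := htop _ hxw hne
  have hyt : f (y + w) < f t := by
    rw [map_add] at hxt ⊢
    linarith [hxmax y hy]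
  have spindle_mem : t ∈ spindle C (x + w) (y + w) := by
    refine mem_spindle_of_forall_apply_nonpos (n := f.toLinearMap) hC.2.1 hxw hyw ht hxt hyt
      fun w' hw' => ?_
    have hle : f (w + w') ≤ f w := hwmax <| shiftsInto_pair_iff.2 <| by
      simpa only [shiftsInto_pair_iff, add_assoc] using hw'
    simpa using hle
  have hK' : t - w ∈ K := hs x hx y hy <| mem_spindle.2 fun w' hxw' hyw' => by
    simpa [add_comm_sub] using mem_spindle.1 spindle_mem (w' - w) (by simpa) (by simpa)
  have hle := hxmax _ hK'
  rw [map_sub] at hle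
  rw [map_add] at hxt
  linarith

theorem IsSpindleConvex.eq_translateHull (hC : IsConvexBody C) (hs : IsSpindleConvex C K)
    (hK : IsClosed K) (hne : K.Nonempty) (huniv : K ≠ univ) : K = translateHull C K := by
  refine subset_translateHull.antisymm fun p hp => ?_
  by_contra hpK
  have hKcomp : IsCompact K :=
    Metric.isCompact_of_isClosed_isBounded hK (hs.isBounded hC.1.isBounded huniv)
  obtain ⟨f, r, hfK, hfp⟩ := geometric_hahn_banach_closed_point (hs.convex hC.2.1) hK hpK
  have separating : {g : StrongDual ℝ E | ∀ x ∈ K, g x < g p} ∈ 𝓝 f := by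
    refine hKcomp.eventually_forall_of_forall_eventually
      (P := fun (g : StrongDual ℝ E) x => g x < g p) fun x hx => ?_
    have eval_continuous : Continuous fun z : StrongDual ℝ E × E => z.1 z.2 := by fun_prop
    have eval_p_continuous : Continuous fun z : StrongDual ℝ E × E => z.1 p := by fun_prop
    exact (isOpen_lt eval_continuous eval_p_continuous).mem_nhds ((hfK x hx).trans hfp)
  obtain ⟨g, hg, t, ht, htop⟩ :=
    exists_mem_nhds_unique_maximizer hC.1 (hC.2.2.mono interior_subset) separating
  obtain ⟨x, hx, hxmax⟩ := hKcomp.exists_isMaxOn hne g.continuous.continuousOn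
  have hpt : p + (t - x) ∈ C := mem_translateHull.1 hp _ fun y hy =>
    hs.add_sub_mem hC huniv ht htop hx hxmax hy
  have hle : g (p + (t - x)) ≤ g t := by
    obtain h | h := eq_or_ne (p + (t - x)) t
    · rw [h]
    · exact (htop _ hpt h).le
  rw [map_add, map_sub] at hle
  linarith [hg x hx]

theorem isClosed_and_isSpindleConvex_iff (hC : IsConvexBody C) :
    IsClosed K ∧ IsSpindleConvex C K ↔ IsBallConvex C K := by
  constructor
  · rintro ⟨hK, hs⟩
    obtain rfl | hne := K.eq_empty_or_nonempty
    · exact .inl rfl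
    obtain rfl | huniv := eq_or_ne K univ
    · exact .inr (.inl rfl)
    · exact .inr (.inr (hs.eq_translateHull hC hK hne huniv))
  · intro hK
    refine ⟨?_, fun p hp q hq => translateHull_subset_of_isBallConvex hK
      (insert_nonempty p {q}) (pair_subset hp hq)⟩
    rcases hK with rfl | rfl | hK
    · exact isClosed_empty
    · exact isClosed_univ
    · exact hK ▸ isClosed_translateHull hC.1.isClosed

theorem spindleCaratheodoryNumber_eq_ballCaratheodoryNumber (hC : IsConvexBody C) :
    spindleCaratheodoryNumber C = ballCaratheodoryNumber C := by
  simp only [spindleCaratheodoryNumber, ballCaratheodoryNumber, isClosed_and_isSpindleConvex_iff hC]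

end SpindleConvexity

section Boxes

variable {ι E : Type*} [AddCommGroup E] [Module ℝ E] {e : E ≃ₗ[ℝ] ι → ℝ} {l u : ι → ℝ}
  {V : Set E} {p w x y z : E}

theorem add_mem_box_iff :
    x + w ∈ e ⁻¹' Icc l u ↔ ∀ i, e x i + e w i ∈ Icc (l i) (u i) := by
  simp only [mem_preimage, map_add, mem_Icc, Pi.le_def, Pi.add_apply, forall_and]

theorem mem_spindle_box (h : ∀ i, e p i ∈ uIcc (e y i) (e z i)) :
    p ∈ spindle (e ⁻¹' Icc l u) y z := by
  refine mem_spindle.2 fun w hyw hzw => add_mem_box_iff.2 fun i => ?_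
  refine uIcc_subset_Icc (add_mem_box_iff.1 hyw i) (add_mem_box_iff.1 hzw i) ?_
  rw [← image_add_const_uIcc]
  exact mem_image_of_mem _ (h i)

theorem spindle_box_eq_univ {i : ι} (h : u i - l i < e z i - e y i) :
    spindle (e ⁻¹' Icc l u) y z = univ := by
  refine translateHull_eq_univ (eq_empty_of_forall_notMem fun w hw => ?_)
  obtain ⟨hyw, hzw⟩ := shiftsInto_pair_iff.1 hw
  linarith [(add_mem_box_iff.1 hyw i).1, (add_mem_box_iff.1 hzw i).2]

theorem exists_apply_ge_of_mem_translateHull_box (hV : V.Finite) (hVne : V.Nonempty)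
    (hgap : ∀ y ∈ V, ∀ z ∈ V, ∀ i, e z i - e y i ≤ u i - l i)
    (hp : p ∈ translateHull (e ⁻¹' Icc l u) V) (i : ι) : ∃ y ∈ V, e p i ≤ e y i := by
  choose top top_mem le_top using fun j => exists_max_image V (e · j) hV hVne
  have hw := mem_translateHull.1 hp (e.symm fun j => u j - e (top j) j) fun v hv =>
    add_mem_box_iff.2 fun j => by
      rw [e.apply_symm_apply]
      constructor <;> linarith [hgap v hv _ (top_mem j) j, le_top j v hv]
  have upper := (add_mem_box_iff.1 hw i).2
  rw [e.apply_symm_apply] at upper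
  exact ⟨top i, top_mem i, by linarith⟩

theorem exists_apply_le_of_mem_translateHull_box (hV : V.Finite) (hVne : V.Nonempty)
    (hgap : ∀ y ∈ V, ∀ z ∈ V, ∀ i, e z i - e y i ≤ u i - l i)
    (hp : p ∈ translateHull (e ⁻¹' Icc l u) V) (i : ι) : ∃ y ∈ V, e y i ≤ e p i := by
  choose bot bot_mem bot_le using fun j => exists_min_image V (e · j) hV hVne
  have hw := mem_translateHull.1 hp (e.symm fun j => l j - e (bot j) j) fun v hv =>
    add_mem_box_iff.2 fun j => by
      rw [e.apply_symm_apply]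
      constructor <;> linarith [hgap _ (bot_mem j) v hv j, bot_le j v hv]
  have lower := (add_mem_box_iff.1 hw i).1
  rw [e.apply_symm_apply] at lower
  exact ⟨bot i, bot_mem i, by linarith⟩

end Boxes

theorem exists_mem_uIcc_and_mem_uIcc {X α β : Type*} [LinearOrder α] [LinearOrder β] {V : Set X}
    {f : X → α} {g : X → β} {a : α} {b : β} (hfle : ∃ x ∈ V, f x ≤ a) (hlef : ∃ x ∈ V, a ≤ f x)
    (hgle : ∃ x ∈ V, g x ≤ b) (hleg : ∃ x ∈ V, b ≤ g x) :
    ∃ y ∈ V, ∃ z ∈ V, a ∈ uIcc (f y) (f z) ∧ b ∈ uIcc (g y) (g z) := by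
  obtain ⟨left, hleft, hl⟩ := hfle
  obtain ⟨right, hright, hr⟩ := hlef
  obtain ⟨bottom, hbottom, hb⟩ := hgle
  obtain ⟨top, htop, ht⟩ := hleg
  simp only [mem_uIcc]
  by_contra! h
  have hlr := h left hleft right hright
  have hlb := h left hleft bottom hbottom
  have hlt := h left hleft top htop
  have hrb := h right hright bottom hbottom
  have hrt := h right hright top htop
  grind

theorem exists_mem_spindle_of_box {E : Type*} [AddCommGroup E] [Module ℝ E]
    {e : E ≃ₗ[ℝ] Fin 2 → ℝ} {l u : Fin 2 → ℝ} {V : Set E} {p : E} (hV : V.Finite)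
    (hVne : V.Nonempty) (hp : p ∈ translateHull (e ⁻¹' Icc l u) V) :
    ∃ y ∈ V, ∃ z ∈ V, p ∈ spindle (e ⁻¹' Icc l u) y z := by
  by_cases hgap : ∀ y ∈ V, ∀ z ∈ V, ∀ i, e z i - e y i ≤ u i - l i
  · have above := exists_apply_ge_of_mem_translateHull_box hV hVne hgap hp
    have below := exists_apply_le_of_mem_translateHull_box hV hVne hgap hp
    obtain ⟨y, hy, z, hz, h0, h1⟩ :=
      exists_mem_uIcc_and_mem_uIcc (below 0) (above 0) (below 1) (above 1)
    exact ⟨y, hy, z, hz, mem_spindle_box (Fin.forall_fin_two.2 ⟨h0, h1⟩)⟩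
  · push Not at hgap
    obtain ⟨y, hy, z, hz, i, hi⟩ := hgap
    exact ⟨y, hy, z, hz, spindle_box_eq_univ hi ▸ mem_univ p⟩

theorem isParallelogram_iff_exists_linearEquiv {E : Type*} [AddCommGroup E] [Module ℝ E]
    [Fact (finrank ℝ E = 2)] {C : Set E} : IsParallelogram C ↔
    ∃ (e : E ≃ₗ[ℝ] Fin 2 → ℝ) (l u : Fin 2 → ℝ), (∀ i, l i < u i) ∧ C = e ⁻¹' Icc l u := by
  constructor
  · rintro ⟨a, v, w, hli, rfl⟩
    let b := basisOfLinearIndependentOfCardEqFinrank hli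
      (by rw [Fintype.card_fin, Fact.out (p := finrank ℝ E = 2)])
    have hb : ![v, w] = b := by simp [b]
    refine ⟨b.equivFun, b.equivFun a, b.equivFun a + 1, fun i => by simp, ?_⟩
    ext x
    rw [hb, mem_vadd_set_iff_neg_vadd_mem, parallelepiped_basis_eq]
    simp [Pi.le_def, forall_and, add_comm]
  · rintro ⟨e, l, u, hlu, rfl⟩
    have side_ne (i : Fin 2) : u i - l i ≠ 0 := (sub_pos.2 (hlu i)).ne'
    let b := (Basis.ofEquivFun e).isUnitSMul fun i => (side_ne i).isUnit
    have hb : ![b 0, b 1] = b := by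
      ext i
      fin_cases i <;> rfl
    have repr_eq (x : E) (i : Fin 2) : b.repr x i = (u i - l i)⁻¹ * e x i := by
      rw [Basis.repr_isUnitSMul, Units.smul_def, Units.val_inv_eq_inv_val, IsUnit.unit_spec,
        Basis.ofEquivFun_repr_apply, smul_eq_mul]
    refine ⟨e.symm l, b 0, b 1, hb ▸ b.linearIndependent, ?_⟩
    ext x
    rw [hb, mem_vadd_set_iff_neg_vadd_mem, parallelepiped_basis_eq]
    simp only [mem_preimage, mem_Icc, Pi.le_def, mem_ofPred_eq, ← forall_and, repr_eq]
    refine forall_congr' fun i => ?_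
    have side_pos : 0 < u i - l i := sub_pos.2 (hlu i)
    rw [inv_mul_le_iff₀ side_pos, mul_one, ← div_eq_inv_mul, le_div_iff₀ side_pos]
    simp [neg_add_eq_sub]

theorem IsParallelogram.ballCaratheodoryNumber_eq_two {E : Type*} [NormedAddCommGroup E]
    [NormedSpace ℝ E] [Fact (finrank ℝ E = 2)] {C : Set E} (hC : IsConvexBody C)
    (hP : IsParallelogram C) : ballCaratheodoryNumber C = 2 := by
  have : Nontrivial E := nontrivial_of_finrank_eq_succ (R := ℝ) (n := 1) Fact.out
  refine le_antisymm (ballCaratheodoryNumber_le two_pos fun V hVne hV p hp => ?_)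
    (two_le_ballCaratheodoryNumber hC.1.isBounded (hC.2.2.mono interior_subset) hC.2.1)
  obtain ⟨W, hWV, hWcard, hpW⟩ := exists_encard_le_three hC hVne hV hp
  obtain rfl | hWne := W.eq_empty_or_nonempty
  · exact ⟨∅, hWV, by simp, hpW⟩
  obtain ⟨e, l, u, -, rfl⟩ := isParallelogram_iff_exists_linearEquiv.1 hP
  obtain ⟨y, hy, z, hz, hyz⟩ :=
    exists_mem_spindle_of_box (finite_of_encard_le_coe hWcard) hWne hpW
  refine ⟨{y, z}, pair_subset (hWV hy) (hWV hz), ?_, hyz⟩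
  grw [encard_insert_le, encard_singleton]
  norm_num

section RegularNormals

variable {E : Type*} [NormedAddCommGroup E] [NormedSpace ℝ E] {C O : Set E}
  {n : StrongDual ℝ E} {d p u : E}

/-- `n` is an outer normal of `C` at a smooth boundary point. Smoothness is encoded as the tangent
cone being a half-space: from that point, every direction on which `n` is negative leads into the
interior of `C`. -/
def IsRegularNormal (C : Set E) (n : StrongDual ℝ E) : Prop :=
  n ≠ 0 ∧ ∃ x ∈ C, IsMaxOn n C x ∧ ∀ d, n d < 0 → ∃ ε : ℝ, 0 < ε ∧ x + ε • d ∈ interior C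

theorem IsRegularNormal.smul (hn : IsRegularNormal C n) {r : ℝ} (hr : 0 < r) :
    IsRegularNormal C (r • n) := by
  obtain ⟨hn0, x, hx, hmax, hreg⟩ := hn
  refine ⟨smul_ne_zero hr.ne' hn0, x, hx, fun y hy => ?_, fun d hd => hreg d ?_⟩
  · exact mul_le_mul_of_nonneg_left (hmax hy) hr.le
  · exact (pos_iff_neg_of_mul_neg hd).1 hr

theorem IsRegularNormal.of_vadd (hn : IsRegularNormal (u +ᵥ C) n) : IsRegularNormal C n := by
  obtain ⟨hn0, _, ⟨x, hx, rfl⟩, hmax, hreg⟩ := hn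
  refine ⟨hn0, x, hx, fun y hy => ?_, fun d hd => ?_⟩
  · simpa using hmax (vadd_mem_vadd_set hy)
  · obtain ⟨ε, hε, hint⟩ := hreg d hd
    rw [interior_vadd, mem_vadd_set_iff_neg_vadd_mem] at hint
    exact ⟨ε, hε, by simpa [add_assoc] using hint⟩

theorem fderiv_gauge_self (hp : DifferentiableAt ℝ (gauge C) p) :
    fderiv ℝ (gauge C) p p = gauge C p := by
  have along_ray : HasDerivAt (fun t : ℝ => (1 + t) * gauge C p) (gauge C p) 0 := by
    simpa using ((hasDerivAt_id (0 : ℝ)).const_add 1).mul_const (gauge C p)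
  refine (hp.hasFDerivAt.hasLineDerivAt p).unique (along_ray.congr_of_eventuallyEq ?_)
  filter_upwards [lt_mem_nhds (neg_one_lt_zero (R := ℝ))] with t ht
  rw [← smul_eq_mul, ← gauge_smul_of_nonneg (by linarith), add_smul, one_smul]

theorem fderiv_gauge_le (hC : Convex ℝ C) (habs : Absorbent ℝ C)
    (hp : DifferentiableAt ℝ (gauge C) p) (v : E) : fderiv ℝ (gauge C) p v ≤ gauge C v := by
  refine le_of_tendsto (hp.hasFDerivAt.hasLineDerivAt v).tendsto_slope_zero_right ?_
  filter_upwards [self_mem_nhdsWithin] with t (ht : 0 < t)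
  have subadditive := gauge_add_le hC habs p (t • v)
  rw [gauge_smul_of_nonneg ht.le, smul_eq_mul] at subadditive
  simp only [smul_eq_mul]
  rw [inv_mul_le_iff₀ ht]
  linarith

theorem isRegularNormal_fderiv_gauge (hC : Convex ℝ C) (hcl : IsClosed C) (hnhds : C ∈ 𝓝 0)
    (hp : DifferentiableAt ℝ (gauge C) p) (hpos : 0 < gauge C p) :
    IsRegularNormal C (fderiv ℝ (gauge C) p) := by
  set n := fderiv ℝ (gauge C) p
  have apply_foot : n ((gauge C p)⁻¹ • p) = 1 := by
    rw [map_smul, fderiv_gauge_self hp, smul_eq_mul, inv_mul_cancel₀ hpos.ne']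
  have mem_iff (x : E) : gauge C x ≤ 1 ↔ x ∈ C := by
    rw [gauge_le_one_iff_mem_closure hC hnhds, hcl.closure_eq]
  refine ⟨fun h => by simp [h] at apply_foot, (gauge C p)⁻¹ • p, ?_, fun y hy => ?_,
    fun d hd => ?_⟩
  · rw [← mem_iff, gauge_smul_of_nonneg (inv_nonneg.2 hpos.le), smul_eq_mul,
      inv_mul_cancel₀ hpos.ne']
  · exact ((fderiv_gauge_le hC (absorbent_nhds_zero hnhds) hp y).trans
      ((mem_iff y).2 hy)).trans_eq apply_foot.symm
  · have slope_neg := (hp.hasFDerivAt.hasLineDerivAt d).tendsto_slope_zero_right.eventually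
      (gt_mem_nhds hd)
    obtain ⟨t, hslope, ht : 0 < t⟩ := (slope_neg.and self_mem_nhdsWithin).exists
    simp only [smul_eq_mul] at hslope
    have decrease : gauge C (p + t • d) < gauge C p :=
      sub_neg.1 ((pos_iff_neg_of_mul_neg hslope).1 (inv_pos.2 ht))
    refine ⟨(gauge C p)⁻¹ * t, by positivity, ?_⟩
    rw [← gauge_lt_one_iff_mem_interior hC hnhds, mul_smul, ← smul_add,
      gauge_smul_of_nonneg (inv_nonneg.2 hpos.le), smul_eq_mul, inv_mul_lt_one₀ hpos]
    exact decrease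

variable [FiniteDimensional ℝ E]

theorem dense_differentiableAt_of_lipschitzWith {f : E → ℝ} {K : NNReal} (hf : LipschitzWith K f) :
    Dense {x | DifferentiableAt ℝ f x} := by
  borelize E
  exact MeasureTheory.Measure.dense_of_ae (hf.ae_differentiableAt (μ := .addHaar))

theorem exists_isRegularNormal_of_zero_mem_interior (hC : Convex ℝ C) (hcl : IsClosed C)
    (h0 : 0 ∈ interior C) (hO : IsOpen O) (hne : O.Nonempty) (hdisj : Disjoint O C) :
    ∃ p ∈ O, ∃ n, IsRegularNormal C n ∧ ∀ y ∈ C, n y < n p := by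
  have hnhds : C ∈ 𝓝 0 := mem_interior_iff_mem_nhds.1 h0
  obtain ⟨K, hK⟩ := hC.lipschitz_gauge hnhds
  obtain ⟨p, hpO, hp⟩ :=
    (dense_differentiableAt_of_lipschitzWith hK).inter_open_nonempty O hO hne
  have one_lt : 1 < gauge C p := by
    by_contra! hle
    rw [gauge_le_one_iff_mem_closure hC hnhds, hcl.closure_eq] at hle
    exact disjoint_left.1 hdisj hpO hle
  refine ⟨p, hpO, _, isRegularNormal_fderiv_gauge hC hcl hnhds hp (one_pos.trans one_lt),
    fun y hy => ?_⟩
  rw [fderiv_gauge_self hp]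
  exact ((fderiv_gauge_le hC (absorbent_nhds_zero hnhds) hp y).trans
    (gauge_le_one_of_mem hy)).trans_lt one_lt

theorem exists_isRegularNormal (hC : IsConvexBody C) (hO : IsOpen O) (hne : O.Nonempty)
    (hdisj : Disjoint O C) : ∃ p ∈ O, ∃ n, IsRegularNormal C n ∧ ∀ y ∈ C, n y < n p := by
  obtain ⟨c, hc⟩ := hC.2.2
  obtain ⟨_, ⟨p, hp, rfl⟩, n, hn, hsep⟩ :=
    exists_isRegularNormal_of_zero_mem_interior (hC.vadd (-c)).2.1 (hC.vadd (-c)).1.isClosed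
      (by rw [interior_vadd]; exact ⟨c, hc, by simp⟩) (hO.vadd (-c)) hne.vadd_set
      (disjoint_vadd_set.2 hdisj)
  exact ⟨p, hp, n, hn.of_vadd, fun y hy => by simpa using hsep _ (vadd_mem_vadd_set hy)⟩

theorem exists_isRegularNormal_apply_pos (hC : IsConvexBody C) (hd : d ≠ 0) :
    ∃ n, IsRegularNormal C n ∧ 0 < n d := by
  obtain ⟨M, hM, hCM⟩ := hC.1.isBounded.exists_pos_norm_le
  set t := 3 * M / ‖d‖
  have ht : 0 < t := div_pos (by positivity) (norm_pos_iff.2 hd)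
  have norm_shift : ‖t • d‖ = 3 * M := by
    rw [norm_smul, Real.norm_of_nonneg ht.le, div_mul_cancel₀ _ (norm_ne_zero_iff.2 hd)]
  have hdisj : Disjoint (t • d +ᵥ interior C) C := by
    refine disjoint_left.2 ?_
    rintro _ ⟨x, hx, rfl⟩ (hxd : t • d + x ∈ C)
    have triangle := norm_sub_le (t • d + x) x
    rw [add_sub_cancel_right, norm_shift] at triangle
    linarith [hCM x (interior_subset hx), hCM _ hxd]
  obtain ⟨_, ⟨p, hp, rfl⟩, n, hn, hsep⟩ :=
    exists_isRegularNormal hC (isOpen_interior.vadd _) hC.2.2.vadd_set hdisj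
  have apply_lt := hsep p (interior_subset hp)
  simp only [vadd_eq_add, map_add, map_smul, smul_eq_mul] at apply_lt
  exact ⟨n, hn, pos_of_mul_pos_right (by linarith) ht.le⟩

end RegularNormals

section LowerBound

theorem subset_pair_of_encard_lt_three {α : Type*} {W : Set α} {a b c : α} (hW : W ⊆ {a, b, c})
    (hcard : W.encard < 3) : W ⊆ {a, b} ∨ W ⊆ {b, c} ∨ W ⊆ {a, c} := by
  by_contra! hsub
  obtain ⟨hab, hbc, hac⟩ := hsub
  refine hcard.not_ge ?_
  have eq_triple : W = {a, b, c} := by grind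
  rw [eq_triple, encard_eq_three.2 ⟨a, b, c, by grind, by grind, by grind, rfl⟩]

variable {E : Type*} [NormedAddCommGroup E] [NormedSpace ℝ E] {C : Set E}
  {n n₁ n₂ n₃ : StrongDual ℝ E} {a b c v v' : E}

theorem eventually_add_smul_mem_interior (hC : Convex ℝ C) {x d : E} (hx : x ∈ C) {r : ℝ}
    (hr : 0 < r) (hd : x + r • d ∈ interior C) :
    ∀ᶠ ε : ℝ in 𝓝[>] 0, x + ε • d ∈ interior C := by
  filter_upwards [Ioo_mem_nhdsGT hr] with ε hε
  have shrink := hC.add_smul_mem_interior hx hd (t := ε / r)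
    ⟨div_pos hε.1 hr, (div_le_one hr).2 hε.2.le⟩
  rwa [smul_smul, div_mul_cancel₀ _ hr.ne'] at shrink

theorem IsRegularNormal.eventually_notMem_spindle (hn : IsRegularNormal C n) (hC : Convex ℝ C)
    (hv : n v < 0) (hv' : n v' < 0) :
    ∀ᶠ ε : ℝ in 𝓝[>] 0, 0 ∉ spindle C (ε • v) (ε • v') := by
  obtain ⟨hn0, x, hx, hmax, hreg⟩ := hn
  obtain ⟨r, hr, hrv⟩ := hreg v hv
  obtain ⟨r', hr', hrv'⟩ := hreg v' hv'
  filter_upwards [eventually_add_smul_mem_interior hC hx hr hrv,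
    eventually_add_smul_mem_interior hC hx hr' hrv'] with ε hε hε' h0
  have eventually_add_mem {u : E} (hu : x + u ∈ interior C) : ∀ᶠ w in 𝓝 x, u + w ∈ C := by
    rw [add_comm] at hu
    exact (continuous_const_add u).continuousAt.eventually_mem (mem_interior_iff_mem_nhds.1 hu)
  have localMax : IsLocalMax n x := by
    filter_upwards [eventually_add_mem hε, eventually_add_mem hε'] with w hw hw'
    exact hmax (by simpa using mem_spindle.1 h0 w hw hw')
  exact hn0 (localMax.hasFDerivAt_eq_zero n.hasFDerivAt)

theorem three_le_ballCaratheodoryNumber (hC : Convex ℝ C) (h₁ : IsRegularNormal C n₁)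
    (h₂ : IsRegularNormal C n₂) (h₃ : IsRegularNormal C n₃) (habc : a + b + c = 0)
    (h₁a : n₁ a < 0) (h₁b : n₁ b < 0) (h₂b : n₂ b < 0) (h₂c : n₂ c < 0)
    (h₃a : n₃ a < 0) (h₃c : n₃ c < 0) : 3 ≤ ballCaratheodoryNumber C := by
  obtain ⟨ε, hab, hbc, hac⟩ := ((h₁.eventually_notMem_spindle hC h₁a h₁b).and
    ((h₂.eventually_notMem_spindle hC h₂b h₂c).and
      (h₃.eventually_notMem_spindle hC h₃a h₃c))).exists
  refine le_ballCaratheodoryNumber (V := {ε • a, ε • b, ε • c}) (p := 0) (insert_nonempty _ _)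
    (toFinite _).isClosed ?_ fun W hW hcard hmem => ?_
  · obtain ⟨ha, hb, hc⟩ : ε • a ∈ translateHull C {ε • a, ε • b, ε • c} ∧ _ ∧ _ := by
      simpa only [insert_subset_iff, singleton_subset_iff] using
        subset_translateHull (C := C) (A := {ε • a, ε • b, ε • c})
    have hull_convex := convex_translateHull hC (A := {ε • a, ε • b, ε • c})
    convert hull_convex ha (hull_convex hb hc one_half_pos.le one_half_pos.le (add_halves 1))
      (a := 1 / 3) (b := 2 / 3) (by norm_num) (by norm_num) (by norm_num) using 1
    rw [eq_neg_of_add_eq_zero_right habc]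
    module
  · rcases subset_pair_of_encard_lt_three hW hcard with h | h | h
    · exact hab (translateHull_mono h hmem)
    · exact hbc (translateHull_mono h hmem)
    · exact hac (translateHull_mono h hmem)

variable [Fact (finrank ℝ E = 2)]

theorem three_le_ballCaratheodoryNumber_of_isRegularNormal_neg_add (hC : Convex ℝ C)
    (h₁ : IsRegularNormal C n₁) (h₂ : IsRegularNormal C n₂)
    (h₃ : IsRegularNormal C (-(n₁ + n₂))) {d : E} (hd₁ : n₁ d = 0) (hd₂ : n₂ d ≠ 0) :
    3 ≤ ballCaratheodoryNumber C := by
  obtain ⟨e, he₁, he₂⟩ := exists_basis_coord_eq (f := n₁.toLinearMap) (g := n₂.toLinearMap)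
    (fun h => h₁.1 (ContinuousLinearMap.coe_injective h)) hd₁ hd₂
  have n₁_apply (x : E) : n₁ x = e.repr x 0 := (LinearMap.congr_fun he₁ x).symm
  have n₂_apply (x : E) : n₂ x = e.repr x 1 := (LinearMap.congr_fun he₂ x).symm
  refine three_le_ballCaratheodoryNumber hC h₁ h₂ h₃ (a := -e 0 + (2 : ℝ) • e 1)
    (b := -e 0 - e 1) (c := (2 : ℝ) • e 0 - e 1) (by module) ?_ ?_ ?_ ?_ ?_ ?_ <;>
    norm_num [n₁_apply, n₂_apply]

end LowerBound

section SymmetricCones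

variable {E : Type*} [NormedAddCommGroup E] [NormedSpace ℝ E] {N : Set (StrongDual ℝ E)}
  {k m n : StrongDual ℝ E} {d x : E}

theorem exists_apply_neg_apply_pos (hm : m ≠ 0) (hmd : m d = 0) (hnd : n d ≠ 0) :
    ∃ x, m x < 0 ∧ 0 < n x := by
  obtain ⟨e, he⟩ := DFunLike.ne_iff.1 hm
  refine ⟨-m e • e + ((1 + m e * n e) / n d) • d, ?_, ?_⟩
  · simpa [hmd] using mul_self_pos.2 he
  · simp [hnd]

theorem exists_mem_apply_pos_and_apply_neg (hspan : ∀ d, d ≠ 0 → ∃ n ∈ N, 0 < n d) (hm : m ≠ 0)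
    (hd : d ≠ 0) (hmd : m d = 0) (hne : ∀ n ∈ N, ∀ x, m x < 0 → 0 < n x → n d ≠ 0) :
    ∃ x, m x < 0 ∧ (∃ n ∈ N, 0 < n d ∧ 0 < n x) ∧ ∃ n ∈ N, n d < 0 ∧ 0 < n x := by
  let U (d : E) : Set E := ⋃ n ∈ {n ∈ N | 0 < n d}, {x | 0 < n x}
  have isOpen_U (d : E) : IsOpen (U d) :=
    isOpen_biUnion fun n _ => isOpen_lt continuous_const n.continuous
  have mem_U {d x : E} : x ∈ U d ↔ ∃ n ∈ N, 0 < n d ∧ 0 < n x := by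
    simp [U, and_assoc]
  have cover : {x | m x < 0} ⊆ U d ∪ U (-d) := by
    intro x (hx : m x < 0)
    obtain ⟨n, hn, hnx⟩ := hspan x (fun h => hx.ne (by rw [h, map_zero]))
    rcases (hne n hn x hx hnx).lt_or_gt with hnd | hnd
    · exact .inr (mem_U.2 ⟨n, hn, by simpa using hnd, hnx⟩)
    · exact .inl (mem_U.2 ⟨n, hn, hnd, hnx⟩)
  have meets {d : E} (hd : d ≠ 0) (hmd : m d = 0) : ({x | m x < 0} ∩ U d).Nonempty := by
    obtain ⟨n, hn, hnd⟩ := hspan d hd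
    obtain ⟨x, hmx, hnx⟩ := exists_apply_neg_apply_pos hm hmd hnd.ne'
    exact ⟨x, hmx, mem_U.2 ⟨n, hn, hnd, hnx⟩⟩
  -- The half-plane `m < 0` is connected, so it is not split by the open sets `U d` and `U (-d)`.
  obtain ⟨x, hmx, hxU, hxU'⟩ :=
    (convex_halfSpace_lt m.isLinear 0).isPreconnected _ _ (isOpen_U d) (isOpen_U (-d)) cover
      (meets hd hmd) (meets (neg_ne_zero.2 hd) (by simpa using hmd))
  exact ⟨x, hmx, mem_U.1 hxU, by simpa using mem_U.1 hxU'⟩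

variable [Fact (finrank ℝ E = 2)]

theorem exists_eq_neg_smul_of_apply_eq_zero (hd : d ≠ 0) (hmd : m d = 0) (hkd : k d = 0)
    (hmx : m x < 0) (hkx : 0 < k x) : ∃ r : ℝ, 0 < r ∧ k = -(r • m) := by
  refine ⟨k x / -m x, div_pos hkx (neg_pos.2 hmx), ContinuousLinearMap.ext fun y => ?_⟩
  obtain ⟨t, ht⟩ := exists_eq_smul_of_apply_eq_zero (f := m.toLinearMap)
    (x := y - (m y / m x) • x) (fun h => hmx.ne (LinearMap.congr_fun h x)) hd hmd
    (by simp [hmx.ne])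
  have k_apply := congrArg k ht
  simp only [map_sub, map_smul, hkd, smul_eq_mul, mul_zero, sub_eq_zero] at k_apply
  rw [k_apply, neg_apply, smul_apply, smul_eq_mul]
  field_simp

theorem neg_mem_of_forall_neg_add_mem (hsmul : ∀ n ∈ N, ∀ r : ℝ, 0 < r → r • n ∈ N)
    (hspan : ∀ d, d ≠ 0 → ∃ n ∈ N, 0 < n d)
    (hno : ∀ n₁ ∈ N, ∀ n₂ ∈ N, -(n₁ + n₂) ∈ N → ∀ d, n₁ d = 0 → n₂ d = 0) (hm : m ∈ N) :
    -m ∈ N := by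
  obtain rfl | hm0 := eq_or_ne m 0
  · rwa [neg_zero]
  obtain ⟨d, hd, hmd⟩ := exists_ne_zero_apply_eq_zero m.toLinearMap
  replace hmd : m d = 0 := hmd
  by_contra hneg
  have apply_ne_zero : ∀ n ∈ N, ∀ x, m x < 0 → 0 < n x → n d ≠ 0 := by
    intro n hn x hmx hnx hnd
    obtain ⟨r, hr, rfl⟩ := exists_eq_neg_smul_of_apply_eq_zero hd hmd hnd hmx hnx
    refine hneg ?_
    rw [← inv_smul_smul₀ hr.ne' (-m), smul_neg]
    exact hsmul _ hn r⁻¹ (inv_pos.2 hr)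
  obtain ⟨x, hmx, ⟨n, hn, hnd, hnx⟩, n', hn', hnd', hnx'⟩ :=
    exists_mem_apply_pos_and_apply_neg hspan hm0 hd hmd apply_ne_zero
  have hnd'_neg : 0 < -n' d := neg_pos.2 hnd'
  obtain ⟨r, hr, sum_eq⟩ := exists_eq_neg_smul_of_apply_eq_zero (k := -n' d • n + n d • n')
    hd hmd (by simp; ring) hmx (by simp only [add_apply, smul_apply, smul_eq_mul]; positivity)
  have parallel := hno (r • m) (hsmul m hm r hr) (-n' d • n) (hsmul n hn _ hnd'_neg)
    (by convert hsmul n' hn' _ hnd using 1; rw [eq_sub_of_add_eq' sum_eq]; abel) d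
    (by simp [hmd])
  exact (mul_pos hnd'_neg hnd).ne' parallel

theorem exists_basis_of_forall_neg_add_mem (hsmul : ∀ n ∈ N, ∀ r : ℝ, 0 < r → r • n ∈ N)
    (hspan : ∀ d, d ≠ 0 → ∃ n ∈ N, 0 < n d)
    (hno : ∀ n₁ ∈ N, ∀ n₂ ∈ N, -(n₁ + n₂) ∈ N → ∀ d, n₁ d = 0 → n₂ d = 0) :
    ∃ b : Basis (Fin 2) ℝ E, ∀ k ∈ N, ∃ i, ∀ j ≠ i, k (b j) = 0 := by
  have smul_mem {m : StrongDual ℝ E} (hm : m ∈ N) {r : ℝ} (hr : r ≠ 0) : r • m ∈ N := by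
    rcases hr.lt_or_gt with hr | hr
    · simpa using
        hsmul (-m) (neg_mem_of_forall_neg_add_mem hsmul hspan hno hm) (-r) (neg_pos.2 hr)
    · exact hsmul m hm r hr
  have : Nontrivial E := nontrivial_of_finrank_eq_succ (R := ℝ) (n := 1) Fact.out
  obtain ⟨v, hv⟩ := exists_ne (0 : E)
  obtain ⟨m, hm, hmv⟩ := hspan v hv
  obtain ⟨d, hd, hmd⟩ := exists_ne_zero_apply_eq_zero m.toLinearMap
  obtain ⟨n, hn, hnd⟩ := hspan d hd
  obtain ⟨b, hb₀, hb₁⟩ := exists_basis_coord_eq (f := m.toLinearMap) (g := n.toLinearMap)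
    (fun h => hmv.ne' (LinearMap.congr_fun h v)) hmd hnd.ne'
  have m_apply (x : E) : m x = b.repr x 0 := (LinearMap.congr_fun hb₀ x).symm
  have n_apply (x : E) : n x = b.repr x 1 := (LinearMap.congr_fun hb₁ x).symm
  have apply_eq_zero {k : StrongDual ℝ E} (hk : k ∈ N) : k (b 0) = 0 ∨ k (b 1) = 0 := by
    by_contra! hkb
    have decomposition : k = -(-k (b 0) • m + -k (b 1) • n) := by
      refine ContinuousLinearMap.coe_injective (b.ext (Fin.forall_fin_two.2 ⟨?_, ?_⟩)) <;>
        simp [m_apply, n_apply]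
    have parallel := hno (-k (b 0) • m) (smul_mem hm (neg_ne_zero.2 hkb.1)) (-k (b 1) • n)
      (smul_mem hn (neg_ne_zero.2 hkb.2)) (decomposition ▸ hk) (b 1) (by simp [m_apply])
    simp [n_apply, hkb.2] at parallel
  refine ⟨b, fun k hk => ?_⟩
  rcases apply_eq_zero hk with h | h
  · exact ⟨1, by simpa [Fin.forall_fin_two] using h⟩
  · exact ⟨0, by simpa [Fin.forall_fin_two] using h⟩

end SymmetricCones

section Parallelograms

variable {E : Type*} [NormedAddCommGroup E] [NormedSpace ℝ E] {C D : Set E}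

theorem subset_of_forall_isRegularNormal [FiniteDimensional ℝ E] (hC : IsConvexBody C)
    (hD : Convex ℝ D) (hCD : C ⊆ D)
    (h : ∀ n, IsRegularNormal C n → ∀ p ∈ D, ∃ y ∈ C, n p ≤ n y) : D ⊆ C := by
  intro x hx
  by_contra hxC
  have x_mem_closure : x ∈ closure (interior D) := by
    rw [hD.closure_interior_eq_closure_of_nonempty_interior (hC.2.2.mono (interior_mono hCD))]
    exact subset_closure hx
  obtain ⟨p, hp, n, hn, hsep⟩ := exists_isRegularNormal hC (O := Cᶜ ∩ interior D)
    (hC.1.isClosed.isOpen_compl.inter isOpen_interior)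
    (mem_closure_iff.1 x_mem_closure _ hC.1.isClosed.isOpen_compl hxC)
    (disjoint_compl_left.mono_left inter_subset_left)
  obtain ⟨y, hy, hpy⟩ := h n hn p (interior_subset hp.2)
  exact (hsep y hy).not_ge hpy

theorem exists_isLeast_isGreatest_lt [FiniteDimensional ℝ E] (hC : IsConvexBody C)
    {f : E →ₗ[ℝ] ℝ} (hf : f ≠ 0) : ∃ l u, IsLeast (f '' C) l ∧ IsGreatest (f '' C) u ∧ l < u := by
  obtain ⟨c, hc⟩ := hC.2.2
  have image_compact := hC.1.image f.continuous_of_finiteDimensional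
  have image_nonempty : (f '' C).Nonempty := ⟨f c, c, interior_subset hc, rfl⟩
  obtain ⟨l, hl⟩ := image_compact.exists_isLeast image_nonempty
  obtain ⟨u, hu⟩ := image_compact.exists_isGreatest image_nonempty
  have lt_u := apply_lt_of_mem_interior (f := f.toContinuousLinearMap) (by simpa using hf)
    (fun y hy => hu.2 ⟨y, hy, rfl⟩) hc
  exact ⟨l, u, hl, hu, (hl.2 ⟨c, interior_subset hc, rfl⟩).trans_lt lt_u⟩

theorem exists_eq_preimage_Icc_of_forall_isRegularNormal {ι : Type*} [Finite ι]
    (hC : IsConvexBody C) (b : Basis ι ℝ E)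
    (hN : ∀ k, IsRegularNormal C k → ∃ i, ∀ j ≠ i, k (b j) = 0) :
    ∃ l u : ι → ℝ, (∀ i, l i < u i) ∧ C = b.equivFun ⁻¹' Icc l u := by
  classical
  have := Fintype.ofFinite ι
  have : FiniteDimensional ℝ E := b.finiteDimensional_of_finite
  have coord_ne_zero (i : ι) : b.coord i ≠ 0 := fun h => by
    simpa using LinearMap.congr_fun h (b i)
  choose l u hl hu hlu using fun i => exists_isLeast_isGreatest_lt hC (coord_ne_zero i)
  have subset_box : C ⊆ b.equivFun ⁻¹' Icc l u := fun x hx =>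
    ⟨fun i => (hl i).2 ⟨x, hx, rfl⟩, fun i => (hu i).2 ⟨x, hx, rfl⟩⟩
  refine ⟨l, u, hlu, subset_box.antisymm (subset_of_forall_isRegularNormal hC
    ((convex_Icc l u).linear_preimage b.equivFun.toLinearMap) subset_box fun k hk p hp => ?_)⟩
  obtain ⟨i, hi⟩ := hN k hk
  have apply_eq (x : E) : k x = b.coord i x * k (b i) := by
    conv_lhs => rw [← b.sum_equivFun x, map_sum]
    rw [Finset.sum_eq_single i (fun j _ hji => by simp [hi j hji]) (by simp)]
    simp
  obtain ⟨y, hy, hly⟩ := (hl i).1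
  obtain ⟨z, hz, huz⟩ := (hu i).1
  rcases le_total 0 (k (b i)) with hpos | hneg
  · exact ⟨z, hz, by
      rw [apply_eq p, apply_eq z, huz]; exact mul_le_mul_of_nonneg_right (hp.2 i) hpos⟩
  · exact ⟨y, hy, by
      rw [apply_eq p, apply_eq y, hly]; exact mul_le_mul_of_nonpos_right (hp.1 i) hneg⟩

variable [Fact (finrank ℝ E = 2)]

theorem exists_isRegularNormal_neg_add (hC : IsConvexBody C) (hP : ¬ IsParallelogram C) :
    ∃ n₁ n₂, IsRegularNormal C n₁ ∧ IsRegularNormal C n₂ ∧ IsRegularNormal C (-(n₁ + n₂)) ∧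
      ∃ d, n₁ d = 0 ∧ n₂ d ≠ 0 := by
  by_contra! hno
  obtain ⟨b, hb⟩ := exists_basis_of_forall_neg_add_mem (N := {n | IsRegularNormal C n})
    (fun n hn r => hn.smul) (fun d => exists_isRegularNormal_apply_pos hC)
    (fun n₁ h₁ n₂ => hno n₁ n₂ h₁)
  exact hP (isParallelogram_iff_exists_linearEquiv.2
    ⟨b.equivFun, exists_eq_preimage_Icc_of_forall_isRegularNormal hC b hb⟩)

end Parallelograms

theorem mainTheorem6_general {E : Type*} [NormedAddCommGroup E] [NormedSpace ℝ E]
    (hE : finrank ℝ E = 2) {C : Set E} (hC : IsConvexBody C) :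
    (IsParallelogram C →
      spindleCaratheodoryNumber C = 2 ∧ ballCaratheodoryNumber C = 2) ∧
    (¬ IsParallelogram C →
      spindleCaratheodoryNumber C = 3 ∧ ballCaratheodoryNumber C = 3) := by
  have : Fact (finrank ℝ E = 2) := ⟨hE⟩
  rw [spindleCaratheodoryNumber_eq_ballCaratheodoryNumber hC, and_self, and_self]
  refine ⟨fun hP => hP.ballCaratheodoryNumber_eq_two hC, fun hP => ?_⟩
  obtain ⟨n₁, n₂, h₁, h₂, h₃, d, hd₁, hd₂⟩ := exists_isRegularNormal_neg_add hC hP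
  exact (ballCaratheodoryNumber_le_three hC).antisymm
    (three_le_ballCaratheodoryNumber_of_isRegularNormal_neg_add hC.2.1 h₁ h₂ h₃ hd₁ hd₂)

theorem mainTheorem6 (C : Set (EuclideanSpace ℝ (Fin 2))) (hC : IsConvexBody C) :
    (IsParallelogram C →
      spindleCaratheodoryNumber C = 2 ∧ ballCaratheodoryNumber C = 2) ∧
    (¬ IsParallelogram C →
      spindleCaratheodoryNumber C = 3 ∧ ballCaratheodoryNumber C = 3) :=
  mainTheorem6_general finrank_euclideanSpace_fin hC
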